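/- Let $V$ be an $n$-dimensional complex vector space with dual $V^*$. The group $GL(V)$ acts naturally on $V\otimes V^*$, by $g\cdot(v\otimes f)=gv\otimes (f\circ g^{-1})$, and hence by algebra automorphisms on the exterior algebra $\Lambda(V\otimes V^*)$; let $\Lambda(V\otimes V^*)^{GL(V)}$ denote the algebra of invariants. Let $e_1,\dots,e_n$ be a basis of $V$ with dual basis $e_1^*,\dots,e_n^*$, put $x_{ij}=e_i\otimes e_j^*\in V\otimes V^*\subset\Lambda(V\otimes V^*)$, let $X=(x_{ij})_{1\le i,j\le n}\in\operatorname{Mat}_{n,n}(\Lambda(V\otimes V^*))$, and put $$q_k=\operatorname{tr}(X^k)=\sum_{1\le i_1,\dots,i_k\le n}x_{i_1i_2}\wedge x_{i_2i_3}\wedge\cdots\wedge x_{i_ki_1}\qquad(k\ge 1).$$ Then the algebra $\Lambda(V\otimes V^*)^{GL(V)}$ is generated by $q_1,q_3,\dots,q_{2n-1}$. These generators anticommute with each other ($q_kq_l=-q_lq_k$ for all odd $k,l$ with $0<k,l<2n$, including $k=l$) and satisfy no relations besides this anticommutativity: the kernel of the homomorphism from the free associative $\mathbb{C}$-algebra on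 $y_1,\dots,y_n$ to $\Lambda(V\otimes V^*)$ with $y_i\mapsto q_{2i-1}$ is the two-sided ideal generated by the elements $y_iy_j+y_jy_i$ ($1\le i,j\le n$). Namely, the products $$q_{k_1}\cdots q_{k_d},\qquad k_1,\dots,k_d \text{ odd},\quad 0<k_1<\cdots<k_d<2n,\quad d=0,1,\dots,n,$$ form a linear basis of $\Lambda(V\otimes V^*)^{GL(V)}$. Thus $\Lambda(V\otimes V^*)^{GL(V)}$ is isomorphic to the exterior algebra on an $n$-dimensional vector space, by an algebra isomorphism that sends a basis of that space to $q_1,q_3,\dots,q_{2n-1}$. -/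

import Mathlib

open scoped TensorProduct

noncomputable section

namespace ExteriorInvariants

/-- The tautological representation of `GL(V)` on `V`. -/
def stdRep (V : Type*) [AddCommGroup V] [Module ℂ V] :
    Representation ℂ (LinearMap.GeneralLinearGroup ℂ V) V :=
  Units.coeHom (V →ₗ[ℂ] V)

/-- The natural representation of `GL(V)` on `V ⊗ V*`, that is
`g • (v ⊗ f) = g v ⊗ (f ∘ g⁻¹)`. -/
def tensorDualRep (V : Type*) [AddCommGroup V] [Module ℂ V] :
    Representation ℂ (LinearMap.GeneralLinearGroup ℂ V) (V ⊗[ℂ] Module.Dual ℂ V) :=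
  (stdRep V).tprod (stdRep V).dual

/-- The exterior algebra `Λ(V ⊗ V*)`. -/
abbrev Ext (V : Type*) [AddCommGroup V] [Module ℂ V] : Type _ :=
  ExteriorAlgebra ℂ (V ⊗[ℂ] Module.Dual ℂ V)

/-- The natural action of `GL(V)` on `Λ(V ⊗ V*)` by algebra endomorphisms. -/
def extAction (V : Type*) [AddCommGroup V] [Module ℂ V] :
    LinearMap.GeneralLinearGroup ℂ V →* (Ext V →ₐ[ℂ] Ext V) where
  toFun g := ExteriorAlgebra.map (tensorDualRep V g)
  map_one' := by
    rw [map_one]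
    exact ExteriorAlgebra.map_id
  map_mul' g h := by
    rw [map_mul]
    exact (ExteriorAlgebra.map_comp_map _ _).symm

/-- The algebra `Λ(V ⊗ V*)^{GL(V)}` of invariants. -/
def invariants (V : Type*) [AddCommGroup V] [Module ℂ V] : Subalgebra ℂ (Ext V) where
  carrier := {w | ∀ g : LinearMap.GeneralLinearGroup ℂ V, extAction V g w = w}
  mul_mem' ha hb g := by rw [map_mul, ha g, hb g]
  add_mem' ha hb g := by rw [map_add, ha g, hb g]
  algebraMap_mem' r g := (extAction V g).commutes r

/-- The matrix `X = (x_{ij})` with entries `x_{ij} = e_i ⊗ e_j^*` in `Λ(V ⊗ V*)`, where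
`e_1, …, e_n` is the given basis of `V` and `e_1^*, …, e_n^*` is the dual basis. -/
def X {V : Type*} [AddCommGroup V] [Module ℂ V] {n : ℕ} (b : Module.Basis (Fin n) ℂ V) :
    Matrix (Fin n) (Fin n) (Ext V) :=
  Matrix.of fun i j => ExteriorAlgebra.ι ℂ (b i ⊗ₜ[ℂ] b.coord j)

/-- `q_k = tr(X^k)`. -/
def q {V : Type*} [AddCommGroup V] [Module ℂ V] {n : ℕ} (b : Module.Basis (Fin n) ℂ V)
    (k : ℕ) : Ext V :=
  (X b ^ k).trace

/-- For `S = {i_1 < ⋯ < i_d} ⊆ {0, …, n - 1}`, the ordered product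
`q_{2 i_1 + 1} q_{2 i_2 + 1} ⋯ q_{2 i_d + 1}`. -/
def qProd {V : Type*} [AddCommGroup V] [Module ℂ V] {n : ℕ} (b : Module.Basis (Fin n) ℂ V)
    (S : Finset (Fin n)) : Ext V :=
  ((S.sort (· ≤ ·)).map fun i => q b (2 * (i : ℕ) + 1)).prod

/-- The homomorphism from the free associative algebra on `n` generators that sends the `i`-th
generator (`i = 0, …, n - 1`) to `q_{2 i + 1}`; its kernel consists of all relations between
`q_1, q_3, …, q_{2n-1}`. -/
def qHom {V : Type*} [AddCommGroup V] [Module ℂ V] {n : ℕ} (b : Module.Basis (Fin n) ℂ V) :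
    FreeAlgebra ℂ (Fin n) →ₐ[ℂ] Ext V :=
  FreeAlgebra.lift ℂ fun i : Fin n => q b (2 * (i : ℕ) + 1)

/-- The two-sided ideal of the free associative algebra on `n` generators that is generated by the
anticommutators `x_i x_j + x_j x_i` (including `i = j`). -/
def anticommIdeal (n : ℕ) : TwoSidedIdeal (FreeAlgebra ℂ (Fin n)) :=
  TwoSidedIdeal.span {r | ∃ i j : Fin n,
    r = FreeAlgebra.ι ℂ i * FreeAlgebra.ι ℂ j + FreeAlgebra.ι ℂ j * FreeAlgebra.ι ℂ i}

end ExteriorInvariants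

end

/-! The argument combines Schur–Weyl duality, graded commutativity and a count of degrees.

Generation: the degree-`m` coordinates of an invariant form a matrix on the `m`-th tensor power of
`V` that commutes with every `g ⊗ ⋯ ⊗ g`. By Schur–Weyl duality
(`exists_eq_sum_perm_of_commute_tensorPowMatrix`) it is a combination of permutations. Each
permutation contributes a full contraction of entries of `X`, which is up to sign a product of
traces `q_k`, one for each cycle. Even traces vanish by the graded cyclicity of the trace. Hence `X
^ 2`, whose entries commute, has power traces zero, and Cayley–Hamilton gives `X ^ (2 * n) = 0`
(`X_pow_eq_zero`). Only `q_1, q_3, …, q_{2n-1}` survive.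

Independence: the top form of `Λ(V ⊗ V*)` is invariant, because `g` acts on `V ⊗ V*` with
determinant 1. It is therefore a combination of ordered products of the `q_k`. Its degree is `n² = 1
+ 3 + ⋯ + (2n-1)`, which only the product of all generators attains, so that product is nonzero
(`qProd_univ_ne_zero`). For anticommuting elements this alone makes all ordered products independent
(`linearIndependent_sortedProd`). The presentation and the exterior algebra isomorphism follow,
since ordered products also span the algebras that map onto the invariants. -/

namespace ExteriorInvariants

/-! ### Ordered products of anticommuting elements -/

section Anticommuting

variable {ι A : Type*} [Ring A] {a : ι → A}

theorem list_prod_eq_or_eq_neg_of_perm (h : ∀ i j, a i * a j = a j * a i ∨ a i * a j = -(a j * a i))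
    {l l' : List ι} (hl : l.Perm l') :
    (l.map a).prod = (l'.map a).prod ∨ (l.map a).prod = -(l'.map a).prod := by
  induction hl with
  | nil => simp
  | cons x _ ih => rcases ih with ih | ih <;> simp [ih]
  | swap x y l =>
    simp only [List.map_cons, List.prod_cons, ← mul_assoc]
    rcases h y x with h | h <;> simp [h]
  | trans _ _ ih₁ ih₂ => rcases ih₁ with h₁ | h₁ <;> rcases ih₂ with h₂ | h₂ <;> simp [h₁, h₂]

variable [Algebra ℂ A]

theorem mul_self_eq_zero_of_anticomm (h : ∀ i j, a i * a j = -(a j * a i)) (i : ι) :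
    a i * a i = 0 := by
  have h2 : (2 : ℂ) • (a i * a i) = 0 := by
    rw [two_smul]
    nth_rewrite 1 [h i i]
    exact neg_add_cancel _
  exact (smul_eq_zero_iff_right two_ne_zero).1 h2

theorem list_prod_eq_zero_of_not_nodup (h : ∀ i j, a i * a j = -(a j * a i))
    {l : List ι} (hl : ¬ l.Nodup) : (l.map a).prod = 0 := by
  classical
  induction l with
  | nil => simp at hl
  | cons x t ih =>
    by_cases hx : x ∈ t
    · have hp := list_prod_eq_or_eq_neg_of_perm (fun i j => Or.inr (h i j)) (List.perm_cons_erase hx)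
      have hz : a x * (List.map a (x :: t.erase x)).prod = 0 := by
        rw [List.map_cons, List.prod_cons, ← mul_assoc, mul_self_eq_zero_of_anticomm h, zero_mul]
      rw [List.map_cons, List.prod_cons]
      rcases hp with hp | hp <;> simp only [hp, mul_neg, hz, neg_zero]
    · have : ¬ t.Nodup := fun ht => hl (List.nodup_cons.2 ⟨hx, ht⟩)
      rw [List.map_cons, List.prod_cons, ih this, mul_zero]

variable [LinearOrder ι]

/-- The product of the family `a` over the finite set `S`, in increasing order. -/
def sortedProd (a : ι → A) (S : Finset ι) : A := ((S.sort (· ≤ ·)).map a).prod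

theorem list_prod_mem_span_sortedProd (h : ∀ i j, a i * a j = -(a j * a i)) (l : List ι) :
    (l.map a).prod ∈ Submodule.span ℂ (Set.range (sortedProd a)) := by
  by_cases hl : l.Nodup
  · have hp : l.Perm (l.toFinset.sort (· ≤ ·)) :=
      (List.perm_ext_iff_of_nodup hl (Finset.sort_nodup _ _)).2 (by simp)
    have hm : sortedProd a l.toFinset ∈ Submodule.span ℂ (Set.range (sortedProd a)) :=
      Submodule.subset_span ⟨_, rfl⟩
    rcases list_prod_eq_or_eq_neg_of_perm (fun i j => Or.inr (h i j)) hp with hq | hq <;> rw [hq]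
    · exact hm
    · exact neg_mem hm
  · rw [list_prod_eq_zero_of_not_nodup h hl]
    exact zero_mem _

theorem adjoin_range_eq_span_sortedProd (h : ∀ i j, a i * a j = -(a j * a i)) :
    Subalgebra.toSubmodule (Algebra.adjoin ℂ (Set.range a)) =
      Submodule.span ℂ (Set.range (sortedProd a)) := by
  apply le_antisymm
  · rw [Algebra.adjoin_eq_span]
    refine Submodule.span_le.2 fun x hx => ?_
    obtain ⟨l, hl, rfl⟩ := Submonoid.exists_list_of_mem_closure hx
    obtain ⟨l', rfl⟩ : ∃ l' : List ι, l'.map a = l := by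
      rw [← Set.mem_range, Set.range_list_map]
      exact hl
    exact list_prod_mem_span_sortedProd h l'
  · refine Submodule.span_le.2 ?_
    rintro _ ⟨S, rfl⟩
    refine Subalgebra.list_prod_mem _ fun x hx => ?_
    obtain ⟨i, -, rfl⟩ := List.mem_map.1 hx
    exact Algebra.subset_adjoin ⟨i, rfl⟩

/-- In a nontrivial relation, choose `S` of least cardinality with nonzero coefficient and multiply
by the product over `Sᶜ`. Any other `T` that occurs is not contained in `S`, so it shares a factor
with `Sᶜ` and its term dies. What remains is a nonzero multiple of the full product. -/
theorem linearIndependent_sortedProd [Fintype ι] (h : ∀ i j, a i * a j = -(a j * a i))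
    (htop : sortedProd a Finset.univ ≠ 0) : LinearIndependent ℂ (sortedProd a) := by
  have hmul (S T : Finset ι) :
      sortedProd a S * sortedProd a T = ((S.sort (· ≤ ·) ++ T.sort (· ≤ ·)).map a).prod := by
    simp [sortedProd]
  rw [Fintype.linearIndependent_iff]
  by_contra! hcon
  obtain ⟨c, hc, S₀, hS₀⟩ := hcon
  obtain ⟨S, hS, hmin⟩ := Finset.exists_min_image (Finset.univ.filter fun S => c S ≠ 0) Finset.card
    ⟨S₀, by simpa using hS₀⟩
  simp only [Finset.mem_filter, Finset.mem_univ, true_and] at hS hmin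
  have h0 := congrArg (· * sortedProd a Sᶜ) hc
  simp only [Finset.sum_mul, zero_mul, smul_mul_assoc] at h0
  rw [Finset.sum_eq_single S] at h0
  · have hp : (S.sort (· ≤ ·) ++ Sᶜ.sort (· ≤ ·)).Perm ((Finset.univ : Finset ι).sort (· ≤ ·)) := by
      refine (List.perm_ext_iff_of_nodup ?_ (Finset.sort_nodup _ _)).2 fun x => ?_
      · refine List.nodup_append'.2 ⟨Finset.sort_nodup _ _, Finset.sort_nodup _ _, fun x => ?_⟩
        simp
      · simpa using em _
    have h1 := (smul_eq_zero_iff_right hS).1 h0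
    rw [hmul] at h1
    rcases list_prod_eq_or_eq_neg_of_perm (fun i j => Or.inr (h i j)) hp with hq | hq <;>
      rw [hq] at h1
    · exact htop h1
    · exact htop (neg_eq_zero.1 h1)
  · intro T _ hT
    by_cases hcT : c T = 0
    · rw [hcT, zero_smul]
    · have : ¬ T ⊆ S := fun hTS => hT (Finset.eq_of_subset_of_card_le hTS (hmin T hcT))
      obtain ⟨x, hxT, hxS⟩ := Finset.not_subset.1 this
      rw [hmul, list_prod_eq_zero_of_not_nodup h, smul_zero]
      intro hnd
      exact (List.nodup_append'.1 hnd).2.2 (by simpa using hxT) (by simpa using hxS)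
  · simp

end Anticommuting

/-! ### Nilpotency from vanishing traces of powers -/

section TracePowers

open Polynomial Matrix

variable {R ι : Type*} [CommRing R] [Fintype ι] [DecidableEq ι]

/-- In the Leibniz expansion, differentiating the factor at `i` gives 1 if the permutation fixes `i`
and 0 otherwise. This is what the `i`-th diagonal cofactor collects. -/
theorem derivative_charpoly_eq_trace_adjugate (M : Matrix ι ι R) :
    derivative M.charpoly = M.charmatrix.adjugate.trace := by
  rw [Matrix.charpoly, Matrix.det_apply, derivative_sum, Matrix.trace]
  simp only [Matrix.diag_apply, Matrix.adjugate_apply, Matrix.det_apply]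
  rw [Finset.sum_comm]
  refine Finset.sum_congr rfl fun σ _ => ?_
  rw [Units.smul_def, derivative_smul, derivative_prod_finset, Finset.smul_sum]
  refine Finset.sum_congr rfl fun i _ => ?_
  rw [Units.smul_def]
  congr 1
  by_cases hi : σ i = i
  · rw [← Finset.mul_prod_erase _ _ (Finset.mem_univ i), hi]
    simp only [charmatrix_apply_eq, derivative_sub, derivative_X, derivative_C, sub_zero, mul_one,
      updateRow_self, Pi.single_eq_same, one_mul]
    refine Finset.prod_congr rfl fun j hj => ?_
    rw [updateRow_ne]
    rw [← hi]
    exact fun h => (Finset.ne_of_mem_erase hj) (σ.injective h)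
  · rw [charmatrix_apply_ne _ _ _ hi, derivative_neg, derivative_C, neg_zero, mul_zero]
    symm
    refine Finset.prod_eq_zero (Finset.mem_univ (σ.symm i)) ?_
    rw [Equiv.apply_symm_apply, updateRow_self, Pi.single_eq_of_ne]
    intro h
    apply hi
    rw [← h, Equiv.apply_symm_apply]
    exact h.symm

/-- Newton's identities in adjugate form: they force the characteristic polynomial to be a pure
power of the variable, and Cayley–Hamilton finishes. -/
theorem pow_card_eq_zero_of_trace_pow_eq_zero [IsAddTorsionFree R] (M : Matrix ι ι R)
    (h : ∀ k : ℕ, 0 < k → (M ^ k).trace = 0) : M ^ Fintype.card ι = 0 := by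
  -- `B k` is the `k`-th coefficient of the adjugate of `X - M`. Comparing coefficients in `(X - M)
  -- * adj = charpoly` gives a recursion.
  set B : ℕ → Matrix ι ι R := fun k => M.charmatrix.adjugate.map fun p => p.coeff k with hB
  have hmul : M.charmatrix * M.charmatrix.adjugate = M.charpoly • 1 := Matrix.mul_adjugate _
  have hscalar : M.charmatrix = (Polynomial.X : R[X]) • (1 : Matrix ι ι R[X]) - M.map C := by
    ext1 i j
    rw [charmatrix_apply, Matrix.sub_apply, Matrix.smul_apply, Matrix.map_apply, smul_eq_mul,
      Matrix.one_apply, Matrix.diagonal_apply, mul_ite, mul_one, mul_zero]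
  have hentry (i j : ι) : Polynomial.X * M.charmatrix.adjugate i j =
      M.charpoly * (1 : Matrix ι ι R[X]) i j + ∑ l, C (M i l) * M.charmatrix.adjugate l j := by
    have h1 := congrFun (congrFun hmul i) j
    generalize M.charmatrix.adjugate = N at h1 ⊢
    rw [hscalar, sub_mul, smul_mul_assoc, one_mul] at h1
    exact sub_eq_iff_eq_add.1 h1
  have hone (i j : ι) (k : ℕ) : (M.charpoly * (1 : Matrix ι ι R[X]) i j).coeff k =
      M.charpoly.coeff k * (1 : Matrix ι ι R) i j := by
    by_cases hij : i = j <;> simp [hij, Matrix.one_apply]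
  have hsucc (k : ℕ) : B k = M * B (k + 1) + M.charpoly.coeff (k + 1) • 1 := by
    ext i j
    have h1 := congrArg (fun p : R[X] => p.coeff (k + 1)) (hentry i j)
    simp only [coeff_X_mul, coeff_add, finsetSum_coeff, coeff_C_mul, hone] at h1
    simp only [hB, Matrix.map_apply, Matrix.add_apply, Matrix.mul_apply, Matrix.smul_apply,
      smul_eq_mul]
    rw [h1, add_comm]
  have hzero : M * B 0 = -(M.charpoly.coeff 0 • 1) := by
    ext i j
    have h1 := congrArg (fun p : R[X] => p.coeff 0) (hentry i j)
    simp only [coeff_add, finsetSum_coeff, coeff_C_mul, hone, mul_coeff_zero (p := Polynomial.X),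
      coeff_X_zero, zero_mul] at h1
    simp only [hB, Matrix.map_apply, Matrix.neg_apply, Matrix.mul_apply, Matrix.smul_apply,
      smul_eq_mul]
    exact eq_neg_of_add_eq_zero_right h1.symm
  have hlarge : ∃ N, ∀ k, N ≤ k → B k = 0 := by
    refine ⟨(Finset.univ.sup fun i => Finset.univ.sup fun j =>
      (M.charmatrix.adjugate i j).natDegree) + 1, fun k hk => ?_⟩
    ext i j
    refine coeff_eq_zero_of_natDegree_lt (lt_of_lt_of_le (Nat.lt_succ_of_le ?_) hk)
    exact (Finset.le_sup (f := fun j => (M.charmatrix.adjugate i j).natDegree)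
      (Finset.mem_univ j)).trans (Finset.le_sup (f := fun i => Finset.univ.sup fun j =>
      (M.charmatrix.adjugate i j).natDegree) (Finset.mem_univ i))
  -- Descending induction: `B k` is zero for large `k`, and each step of the recursion adds only a
  -- multiple of the trace of a positive power of `M`.
  have htr (k : ℕ) : ∀ j, 0 < j → (M ^ j * B k).trace = 0 := by
    obtain ⟨N, hN⟩ := hlarge
    rcases le_total N k with hk | hk
    · intro j _
      simp [hN k hk]
    · induction hk using Nat.decreasingInduction with
      | self => intro j _; simp [hN N le_rfl]
      | of_succ k _ ih =>
        intro j hj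
        rw [hsucc k, mul_add, ← mul_assoc, ← pow_succ, Matrix.trace_add, ih _ (Nat.succ_pos j),
          mul_smul_comm, mul_one, Matrix.trace_smul, h j hj, smul_zero, add_zero]
  have hder (k : ℕ) : (B k).trace = M.charpoly.coeff (k + 1) * (k + 1) := by
    rw [← coeff_derivative, derivative_charpoly_eq_trace_adjugate]
    exact (finsetSum_coeff _ _ _).symm
  have hcoeff (k : ℕ) (hk : k ≠ Fintype.card ι) : M.charpoly.coeff k = 0 := by
    have hne : (Fintype.card ι : ℤ) - k ≠ 0 := sub_ne_zero.2 (by exact_mod_cast hk.symm)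
    -- The trace of the recursion evaluates the trace of `B (k - 1)` as `card ι` times the
    -- coefficient, the derivative formula as `k` times it. For `k = 0` the bottom equation plays
    -- this role.
    have key : M.charpoly.coeff k * ((Fintype.card ι : R) - k) = 0 := by
      rcases k with _ | k
      · have := congrArg Matrix.trace hzero
        have h1 := htr 0 1 one_pos
        rw [pow_one] at h1
        rw [h1, Matrix.trace_neg, Matrix.trace_smul, Matrix.trace_one, smul_eq_mul] at this
        simpa using this
      · have := congrArg Matrix.trace (hsucc k)
        have h1 := htr (k + 1) 1 one_pos
        rw [pow_one] at h1
        rw [hder, Matrix.trace_add, h1, zero_add, Matrix.trace_smul, Matrix.trace_one,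
          smul_eq_mul] at this
        rw [mul_sub, ← this]
        push_cast
        ring
    have : ((Fintype.card ι : ℤ) - k) • M.charpoly.coeff k = 0 := by
      rw [zsmul_eq_mul, mul_comm]
      simpa using key
    exact (IsAddTorsionFree.zsmul_eq_zero_iff_right hne).1 this
  nontriviality R
  have hp : M.charpoly = Polynomial.X ^ Fintype.card ι := by
    ext k
    rw [coeff_X_pow]
    split_ifs with hk
    · rw [hk]
      have := M.charpoly_monic.coeff_natDegree
      rwa [Matrix.charpoly_natDegree_eq_dim] at this
    · exact hcoeff k hk
  simpa [hp] using M.aeval_self_charpoly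

theorem mapMatrix_pow_card_eq_zero_of_trace_pow_eq_zero {A : Type*} [Ring A] [IsAddTorsionFree A]
    (φ : R →+* A) (hφ : Function.Injective φ) (Y : Matrix ι ι R)
    (h : ∀ k : ℕ, 0 < k → (φ.mapMatrix Y ^ k).trace = 0) :
    φ.mapMatrix Y ^ Fintype.card ι = 0 := by
  have : IsAddTorsionFree R := hφ.isAddTorsionFree φ.toAddMonoidHom
  have htr (k : ℕ) (hk : 0 < k) : (Y ^ k).trace = 0 := by
    apply hφ
    have h1 : φ (Y ^ k).trace = (φ.mapMatrix (Y ^ k)).trace :=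
      AddMonoidHom.map_trace φ.toAddMonoidHom _
    rw [map_zero, h1, map_pow, h k hk]
  rw [← map_pow, pow_card_eq_zero_of_trace_pow_eq_zero Y htr, map_zero]

/-- The entries generate a commutative subring, over which the determinant theory is available. -/
theorem pow_card_eq_zero_of_commute_of_trace_pow_eq_zero {A : Type*} [Ring A] [IsAddTorsionFree A]
    (M : Matrix ι ι A) (hM : ∀ i j k l, M i j * M k l = M k l * M i j)
    (h : ∀ k : ℕ, 0 < k → (M ^ k).trace = 0) : M ^ Fintype.card ι = 0 := by
  let s : Set A := {x | ∃ i j, M i j = x}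
  have hs : ∀ x ∈ s, ∀ y ∈ s, x * y = y * x := by
    rintro _ ⟨i, j, rfl⟩ _ ⟨k, l, rfl⟩
    exact hM i j k l
  let _ : CommRing (Subring.closure s) :=
    { (Subring.closure s).toRing with
      mul_comm := fun x y => (Subring.isMulCommutative_closure hs).is_comm.comm x y }
  exact mapMatrix_pow_card_eq_zero_of_trace_pow_eq_zero (R := Subring.closure s)
    (Subring.closure s).subtype Subtype.val_injective
    (Matrix.of fun i j => ⟨M i j, Subring.subset_closure ⟨i, j, rfl⟩⟩) h

end TracePowers

/-! ### Schur–Weyl duality -/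

section SchurWeyl

theorem exists_perm_comp_eq {ι κ : Type*} [Fintype ι] [DecidableEq κ] {w w' : ι → κ}
    (h : ∀ c, Fintype.card {k // w k = c} = Fintype.card {k // w' k = c}) :
    ∃ σ : Equiv.Perm ι, w' ∘ σ = w :=
  ⟨Equiv.ofFiberEquiv fun c => Fintype.equivOfCardEq (h c),
    funext fun k => Equiv.ofFiberEquiv_map _ k⟩

/-- Words with the same monomial differ by a permutation, so a symmetric `A` depends only on the
monomial. It thus defines a linear form on polynomials, which is applied to `hc`. -/
theorem sum_mul_eq_zero_of_symmetric {ι κ : Type*} [Fintype ι] [DecidableEq ι] [Fintype κ]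
    (c A : (ι → κ) → ℂ)
    (hA : ∀ (σ : Equiv.Perm ι) w, A (w ∘ σ) = A w)
    (hc : ∑ w, MvPolynomial.C (c w) * ∏ k, MvPolynomial.X (R := ℂ) (w k) = 0) :
    ∑ w, c w * A w = 0 := by
  classical
  let mon (w : ι → κ) : κ →₀ ℕ := ∑ k, Finsupp.single (w k) 1
  let α (d : κ →₀ ℕ) : ℂ := if h : ∃ w, mon w = d then A h.choose else 0
  have hmon (w : ι → κ) (d : κ) : mon w d = Fintype.card {k // w k = d} := by
    simp [mon, Finsupp.single_apply, Fintype.card_subtype]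
  have hα (w : ι → κ) : α (mon w) = A w := by
    have hex : ∃ w', mon w' = mon w := ⟨w, rfl⟩
    obtain ⟨σ, hσ⟩ := exists_perm_comp_eq (w := hex.choose) (w' := w) fun d => by
      rw [← hmon, ← hmon, hex.choose_spec]
    simp only [α, dif_pos hex]
    rw [← hσ, hA]
  let L := (MvPolynomial.basisMonomials κ ℂ).constr ℂ α
  have hL (w : ι → κ) :
      L (MvPolynomial.C (c w) * ∏ k, MvPolynomial.X (R := ℂ) (w k)) = c w * A w := by
    have : ∏ k, MvPolynomial.X (R := ℂ) (w k) = MvPolynomial.basisMonomials κ ℂ (mon w) := by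
      rw [MvPolynomial.coe_basisMonomials]
      exact (MvPolynomial.monomial_sum_one _ _).symm
    rw [this, ← MvPolynomial.smul_eq_C_mul, map_smul, Module.Basis.constr_basis, hα, smul_eq_mul]
  have := congrArg L hc
  rw [map_sum, map_zero] at this
  rw [← this]
  exact Finset.sum_congr rfl fun w _ => (hL w).symm

/-- Zariski density of the invertible matrices: `p` times the generic determinant vanishes
everywhere, and the polynomial ring is a domain. -/
theorem mvPolynomial_eq_zero_of_eval_GL {κ : Type*} [Fintype κ] [DecidableEq κ]
    (p : MvPolynomial (κ × κ) ℂ)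
    (hp : ∀ g : GL κ ℂ, MvPolynomial.eval (fun x => (g : Matrix κ κ ℂ) x.1 x.2) p = 0) : p = 0 := by
  have hz : p * (Matrix.mvPolynomialX κ κ ℂ).det = 0 := by
    refine MvPolynomial.funext fun x => ?_
    have hdet : MvPolynomial.eval x (Matrix.mvPolynomialX κ κ ℂ).det =
        (Matrix.of fun i j => x (i, j)).det := by
      rw [RingHom.map_det]
      congr 1
      ext i j
      simp
    rw [map_mul, map_zero, hdet]
    by_cases h : (Matrix.of fun i j => x (i, j)).det = 0
    · rw [h, mul_zero]
    · have := hp (Matrix.GeneralLinearGroup.mkOfDetNeZero _ h)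
      have h2 : MvPolynomial.eval x p = 0 := this
      rw [h2, zero_mul]
  exact (mul_eq_zero.1 hz).resolve_right (Matrix.det_mvPolynomialX_ne_zero κ ℂ)

/-- The matrix of the tensor power `g ⊗ ⋯ ⊗ g`. -/
def tensorPowMatrix {ι κ : Type*} [Fintype ι] (g : Matrix κ κ ℂ) : Matrix (ι → κ) (ι → κ) ℂ :=
  Matrix.of fun I J => ∏ k, g (I k) (J k)

/-- The symmetric group acting on tensors by permutation of the factors. -/
def permRep (ι κ : Type*) : Representation ℂ (Equiv.Perm ι) ((ι → κ) → ℂ) where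
  toFun σ := LinearMap.funLeft ℂ ℂ fun I => I ∘ σ
  map_one' := rfl
  map_mul' _ _ := rfl

theorem permRep_single {ι κ : Type*} [DecidableEq κ] [Fintype ι] (σ : Equiv.Perm ι) (J : ι → κ) :
    permRep ι κ σ (Pi.single (J ∘ σ) 1) = Pi.single J 1 := by
  ext I
  change (Pi.single (J ∘ σ) 1 : (ι → κ) → ℂ) (I ∘ σ) = _
  simp only [Pi.single_apply]
  congr 1
  exact propext ⟨fun h => σ.surjective.injective_comp_right h, fun h => by rw [h]⟩

variable {ι κ : Type*} [Fintype ι] [DecidableEq ι] [Fintype κ] [DecidableEq κ]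

/-- Each entry of `T * A - A * T` is linear in `A`. For `A = g ⊗ ⋯ ⊗ g` it is a polynomial in the
entries of `g` that vanishes on `GL`, hence identically, and so the entry vanishes for every
symmetric `A`. -/
theorem mul_comm_of_commute_tensorPowMatrix (T : Matrix (ι → κ) (ι → κ) ℂ)
    (hT : ∀ g : GL κ ℂ, T * tensorPowMatrix (g : Matrix κ κ ℂ) = tensorPowMatrix g * T)
    (A : Matrix (ι → κ) (ι → κ) ℂ)
    (hA : ∀ (σ : Equiv.Perm ι) I J, A (I ∘ σ) (J ∘ σ) = A I J) : T * A = A * T := by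
  let e := Equiv.arrowProdEquivProdArrow ι (fun _ => κ) (fun _ => κ)
  ext K L
  let c (w : ι → κ × κ) : ℂ :=
    (if (e w).2 = L then T K (e w).1 else 0) - (if (e w).1 = K then T (e w).2 L else 0)
  have key (B : Matrix (ι → κ) (ι → κ) ℂ) :
      ∑ w, c w * B (e w).1 (e w).2 = (T * B) K L - (B * T) K L := by
    rw [Equiv.sum_comp e fun p => ((if p.2 = L then T K p.1 else 0) -
      (if p.1 = K then T p.2 L else 0)) * B p.1 p.2]
    simp only [sub_mul, ite_mul, zero_mul, Finset.sum_sub_distrib]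
    congr 1
    · rw [Fintype.sum_prod_type]
      simp [Matrix.mul_apply]
    · rw [Fintype.sum_prod_type_right]
      simp [Matrix.mul_apply, mul_comm]
  have h := sum_mul_eq_zero_of_symmetric c (fun w => A (e w).1 (e w).2) (fun σ w => hA σ (e w).1 (e w).2) (by
    refine mvPolynomial_eq_zero_of_eval_GL _ fun g => ?_
    have h1 := key (tensorPowMatrix (g : Matrix κ κ ℂ))
    rw [hT g, sub_self] at h1
    rw [← h1, map_sum]
    refine Finset.sum_congr rfl fun w _ => ?_
    simp [tensorPowMatrix, map_prod, e, Equiv.arrowProdEquivProdArrow])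
  rw [key] at h
  exact sub_eq_zero.1 h

open Representation in
-- Double commutant: endomorphisms commuting with permutations have symmetric matrices, so `T`
-- commutes with them. Tensor space is semisimple over the group algebra, and Jacobson density,
-- applied on the finite standard basis, realizes `T` by a group algebra element.
theorem exists_eq_sum_perm_of_commute_tensorPowMatrix (T : Matrix (ι → κ) (ι → κ) ℂ)
    (hT : ∀ g : GL κ ℂ, T * tensorPowMatrix (g : Matrix κ κ ℂ) = tensorPowMatrix g * T) :
    ∃ c : Equiv.Perm ι → ℂ, ∀ I J, T I J = ∑ σ, c σ * if I ∘ σ = J then 1 else 0 := by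
  classical
  let ρ := permRep ι κ
  let M := ρ.asModule
  let e : M ≃ₗ[ℂ] ((ι → κ) → ℂ) := ρ.asModuleEquiv
  let R := MonoidAlgebra ℂ (Equiv.Perm ι)
  have hcomm (φ : Module.End R M) (m : M) :
      e.symm (T.toLin' (e (φ m))) = φ (e.symm (T.toLin' (e m))) := by
    let φ' : ((ι → κ) → ℂ) →ₗ[ℂ] ((ι → κ) → ℂ) :=
      e.toLinearMap ∘ₗ φ.restrictScalars ℂ ∘ₗ e.symm.toLinearMap
    have hφρ (σ : Equiv.Perm ι) (v) : φ' (ρ σ v) = ρ σ (φ' v) := by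
      change e (φ (e.symm (ρ σ v))) = ρ σ (e (φ (e.symm v)))
      have h1 : e.symm (ρ σ v) = MonoidAlgebra.of ℂ _ σ • e.symm v :=
        asModuleEquiv_symm_map_rho ρ σ v
      rw [h1, map_smul]
      have h2 := asModuleEquiv_map_smul ρ (MonoidAlgebra.of ℂ _ σ) (φ (e.symm v))
      rw [asAlgebraHom_of] at h2
      exact h2
    have hsym (σ : Equiv.Perm ι) (I J : ι → κ) :
        φ'.toMatrix' (I ∘ σ) (J ∘ σ) = φ'.toMatrix' I J := by
      rw [LinearMap.toMatrix'_apply, LinearMap.toMatrix'_apply, ← permRep_single σ J, hφρ]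
      rfl
    have h := mul_comm_of_commute_tensorPowMatrix T hT _ hsym
    have h2 := congrArg (fun A => Matrix.toLin' A (e m)) h
    simp only [Matrix.toLin'_mul, Matrix.toLin'_toMatrix', LinearMap.comp_apply] at h2
    have h3 : φ' (e m) = e (φ m) := by simp [φ']
    rw [h3] at h2
    rw [h2]
    simp [φ']
  let f : Module.End (Module.End R M) M :=
    { toFun := fun m => e.symm (T.toLin' (e m))
      map_add' := fun x y => by simp only [map_add]
      map_smul' := fun φ m => hcomm φ m }
  obtain ⟨r, hr⟩ := jacobson_density (R := R) f
    (Finset.univ.image fun J : ι → κ => e.symm (Pi.single J 1))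
  refine ⟨fun σ => r.coeff σ, fun I J => ?_⟩
  have h := hr _ (Finset.mem_image_of_mem _ (Finset.mem_univ J))
  have h2 : T.toLin' (Pi.single J 1) = ρ.asAlgebraHom r (Pi.single J 1) := by
    have := congrArg e h
    rw [show e (r • _) = _ from asModuleEquiv_map_smul ρ r _] at this
    have hes (x : (ι → κ) → ℂ) : ρ.asModuleEquiv (e.symm x) = x := e.apply_symm_apply x
    rw [hes] at this
    simpa [f] using this
  have h3 := congrFun h2 I
  rw [Matrix.toLin'_apply, Matrix.mulVec_single_one, asAlgebraHom_def, MonoidAlgebra.lift_apply,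
    Finsupp.sum_fintype _ _ (by simp)] at h3
  rw [Matrix.col_apply] at h3
  rw [h3, LinearMap.sum_apply, Finset.sum_apply]
  refine Finset.sum_congr rfl fun σ _ => ?_
  change r.coeff σ * (Pi.single J 1 : (ι → κ) → ℂ) (I ∘ σ) = _
  rw [Pi.single_apply]

end SchurWeyl

/-! ### Graded commutativity of the exterior algebra -/

section GradedCommutativity

variable {R M : Type*} [CommRing R] [AddCommGroup M] [Module R M]

theorem mul_comm_of_mem_exteriorPower {p k : ℕ} {x y : ExteriorAlgebra R M}
    (hx : x ∈ ⋀[R]^p M) (hy : y ∈ ⋀[R]^k M) : x * y = (-1) ^ (p * k) * (y * x) := by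
  have h1 (m : M) {p : ℕ} {x : ExteriorAlgebra R M} (hx : x ∈ ⋀[R]^p M) :
      ExteriorAlgebra.ι R m * x = (-1) ^ p * (x * ExteriorAlgebra.ι R m) := by
    induction hx using Submodule.pow_induction_on_left' with
    | algebraMap r => rw [pow_zero, one_mul, Algebra.commutes]
    | add x y i _ _ ihx ihy => rw [mul_add, ihx, ihy, add_mul, mul_add]
    | mem_mul m' hm i x _ ih =>
      obtain ⟨m', rfl⟩ := hm
      have hswap : ExteriorAlgebra.ι R m * ExteriorAlgebra.ι R m' =
          -(ExteriorAlgebra.ι R m' * ExteriorAlgebra.ι R m) :=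
        eq_neg_of_add_eq_zero_left (ExteriorAlgebra.ι_add_mul_swap m m')
      rw [← mul_assoc, hswap, neg_mul, mul_assoc, ih, pow_succ]
      have hc : Commute (ExteriorAlgebra.ι R m') ((-1) ^ i) :=
        ((Commute.one_right _).neg_right).pow_right i
      rw [← mul_assoc _ ((-1) ^ i), hc.eq]
      simp only [mul_neg, mul_one, neg_mul, mul_assoc]
  induction hx using Submodule.pow_induction_on_left' with
  | algebraMap r => rw [zero_mul, pow_zero, one_mul, Algebra.commutes]
  | add x y i _ _ ihx ihy => rw [mul_add, add_mul, ihx, ihy, mul_add]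
  | mem_mul m hm i x _ ih =>
    obtain ⟨m, rfl⟩ := hm
    have hc : Commute (ExteriorAlgebra.ι R m) ((-1) ^ (i * k)) :=
      ((Commute.one_right _).neg_right).pow_right _
    rw [mul_assoc, ih, ← mul_assoc, hc.eq, mul_assoc, ← mul_assoc _ y x, h1 m hy, Nat.succ_mul,
      pow_add]
    simp only [mul_assoc]

end GradedCommutativity

/-! ### Traces of powers of `X` and full contractions -/

section Generators

variable {V : Type*} [AddCommGroup V] [Module ℂ V] {n : ℕ} (b : Module.Basis (Fin n) ℂ V)

theorem X_pow_apply_mem (p : ℕ) (i j : Fin n) :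
    (X b ^ p) i j ∈ ⋀[ℂ]^p (V ⊗[ℂ] Module.Dual ℂ V) := by
  induction p generalizing i j with
  | zero =>
    rw [pow_zero, Matrix.one_apply]
    split_ifs
    · change (1 : Ext V) ∈ LinearMap.range (ExteriorAlgebra.ι ℂ) ^ 0
      rw [pow_zero]
      exact Submodule.one_le.1 le_rfl
    · exact zero_mem _
  | succ p ih =>
    rw [pow_succ, Matrix.mul_apply]
    refine sum_mem fun l _ => ?_
    change (X b ^ p) i l * X b l j ∈ LinearMap.range (ExteriorAlgebra.ι ℂ) ^ (p + 1)
    rw [pow_succ]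
    exact Submodule.mul_mem_mul (ih i l) ⟨_, rfl⟩

theorem q_mem (k : ℕ) : q b k ∈ ⋀[ℂ]^k (V ⊗[ℂ] Module.Dual ℂ V) := by
  rw [q, Matrix.trace]
  exact sum_mem fun i _ => X_pow_apply_mem b k i i

theorem q_anticomm (k l : ℕ) :
    q b (2 * k + 1) * q b (2 * l + 1) = -(q b (2 * l + 1) * q b (2 * k + 1)) := by
  rw [mul_comm_of_mem_exteriorPower (q_mem b _) (q_mem b _), Odd.neg_one_pow, neg_one_mul]
  exact Odd.mul ⟨k, rfl⟩ ⟨l, rfl⟩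

/-- Moving one odd factor `X` cyclically past the odd power `X ^ (2 * k + 1)` costs a sign, so the
trace equals its own negative. -/
theorem q_even_eq_zero (k : ℕ) : q b (2 * (k + 1)) = 0 := by
  have h : q b (2 * (k + 1)) = -q b (2 * (k + 1)) := by
    have h1 : q b (2 * (k + 1)) = (X b ^ 1 * X b ^ (2 * k + 1)).trace := by
      rw [← pow_add, q]
      congr 2
      ring
    have h2 : q b (2 * (k + 1)) = (X b ^ (2 * k + 1) * X b ^ 1).trace := by
      rw [← pow_add, q]
      rfl
    nth_rewrite 1 [h1]
    rw [h2, Matrix.trace, Matrix.trace, ← Finset.sum_neg_distrib]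
    simp only [Matrix.diag_apply, Matrix.mul_apply, ← Finset.sum_neg_distrib]
    rw [Finset.sum_comm]
    refine Finset.sum_congr rfl fun i _ => Finset.sum_congr rfl fun j _ => ?_
    rw [mul_comm_of_mem_exteriorPower (X_pow_apply_mem b _ _ _) (X_pow_apply_mem b _ _ _),
      Odd.neg_one_pow, neg_one_mul]
    exact ⟨k, by ring⟩
  have h2 : (2 : ℂ) • q b (2 * (k + 1)) = 0 := by
    rw [two_smul]
    nth_rewrite 1 [h]
    exact neg_add_cancel _
  exact (smul_eq_zero_iff_right two_ne_zero).1 h2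

/-- Entries of `X ^ 2` have degree 2 and commute, while the traces of its positive powers are even
`q`'s. This is Rosset's route to the Amitsur–Levitzki theorem. -/
theorem X_pow_eq_zero : X b ^ (2 * n) = 0 := by
  have : IsAddTorsionFree (Ext V) := .of_isTorsionFree ℂ _
  have h := pow_card_eq_zero_of_commute_of_trace_pow_eq_zero (X b ^ 2) (fun i j k l => by
    rw [mul_comm_of_mem_exteriorPower (X_pow_apply_mem b _ _ _) (X_pow_apply_mem b _ _ _)]
    norm_num) fun k hk => by
      obtain ⟨k, rfl⟩ := Nat.exists_eq_succ_of_ne_zero hk.ne'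
      rw [← pow_mul]
      exact q_even_eq_zero b k
  rwa [Fintype.card_fin, ← pow_mul] at h

theorem q_eq_zero_of_le {k : ℕ} (hk : 2 * n ≤ k) : q b k = 0 := by
  rw [q, ← Nat.add_sub_cancel' hk, pow_add, X_pow_eq_zero, zero_mul, Matrix.trace_zero]

theorem q_mem_adjoin (k : ℕ) : q b k ∈
    Algebra.adjoin ℂ (Set.range fun i : Fin n => q b (2 * (i : ℕ) + 1)) := by
  rcases Nat.even_or_odd' k with ⟨l, rfl | rfl⟩
  · rcases l with _ | l
    · rw [mul_zero, q, pow_zero, Matrix.trace_one]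
      exact natCast_mem _ _
    · rw [q_even_eq_zero]
      exact zero_mem _
  · rcases lt_or_ge l n with hl | hl
    · exact Algebra.subset_adjoin ⟨⟨l, hl⟩, rfl⟩
    · rw [q_eq_zero_of_le b (by omega)]
      exact zero_mem _

/-- Isolates the summation over the index at `v`; the overwritten value of `J v` accounts for the
factor `n`. -/
theorem sum_eq_smul_sum_update {Λ E : Type*} [Fintype Λ] [DecidableEq Λ] [AddCommMonoid E]
    (F : (Λ → Fin n) → E) (v : Λ) :
    ∑ J, ∑ t, F (Function.update J v t) = n • ∑ J, F J := by
  have h1 (G : (Λ → Fin n) → E) : ∑ J, G J =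
      ∑ p : Fin n × ({j // j ≠ v} → Fin n), G ((Equiv.funSplitAt v (Fin n)).symm p) :=
    (Equiv.sum_comp (Equiv.funSplitAt v (Fin n)).symm G).symm
  rw [h1, h1, Fintype.sum_prod_type, Fintype.sum_prod_type]
  have h2 (s t : Fin n) (J : {j // j ≠ v} → Fin n) :
      Function.update ((Equiv.funSplitAt v (Fin n)).symm (s, J)) v t =
        (Equiv.funSplitAt v (Fin n)).symm (t, J) := by
    ext j
    by_cases hj : j = v
    · subst hj
      simp
    · simp [hj]
  simp only [h2, Finset.sum_const, Finset.card_univ, Fintype.card_fin]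
  rw [Finset.sum_comm]

/-- A full contraction of matrix entries of powers of `X`, i.e. a sum in which each index occurs
once as a row index and once as a column index, is a polynomial in the `q_k`. -/
theorem sum_prod_X_pow_mem_adjoin {Λ : Type*} [Fintype Λ] [DecidableEq Λ] (l : List (ℕ × Λ × Λ))
    (hnd : (l.map fun t => t.2.1).Nodup)
    (hperm : (l.map fun t => t.2.1).Perm (l.map fun t => t.2.2)) :
    ∑ J : Λ → Fin n, (l.map fun t => (X b ^ t.1) (J t.2.1) (J t.2.2)).prod ∈
      Algebra.adjoin ℂ (Set.range fun i : Fin n => q b (2 * (i : ℕ) + 1)) := by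
  set S := Algebra.adjoin ℂ (Set.range fun i : Fin n => q b (2 * (i : ℕ) + 1)) with hS
  -- The case `n = 0` is separate because the main argument divides by `n`.
  rcases Nat.eq_zero_or_pos n with rfl | hn
  · rcases l with _ | ⟨⟨p, u, v⟩, l⟩
    · simp only [List.map_nil, List.prod_nil]
      exact sum_mem fun _ _ => one_mem _
    · have : IsEmpty (Λ → Fin 0) := ⟨fun J => (J u).elim0⟩
      rw [Finset.univ_eq_empty, Finset.sum_empty]
      exact zero_mem _
  have hdiv {E : Ext V} (h : n • E ∈ S) : E ∈ S := by
    have hn' : (n : ℂ) ≠ 0 := Nat.cast_ne_zero.2 hn.ne'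
    rw [← Nat.cast_smul_eq_nsmul ℂ] at h
    simpa [smul_smul, hn'] using S.smul_mem h (n : ℂ)⁻¹
  have hupd (l : List (ℕ × Λ × Λ)) (v : Λ) (h1 : v ∉ l.map fun t => t.2.1)
      (h2 : v ∉ l.map fun t => t.2.2) (J : Λ → Fin n) (s : Fin n) :
      (l.map fun t => (X b ^ t.1) (Function.update J v s t.2.1) (Function.update J v s t.2.2)) =
        l.map fun t => (X b ^ t.1) (J t.2.1) (J t.2.2) := by
    refine List.map_congr_left fun t ht => ?_
    rw [Function.update_of_ne, Function.update_of_ne]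
    · exact fun h => h2 (h ▸ List.mem_map_of_mem ht)
    · exact fun h => h1 (h ▸ List.mem_map_of_mem ht)
  induction hlen : l.length generalizing l with
  | zero =>
    obtain rfl := List.length_eq_zero_iff.1 hlen
    simp only [List.map_nil, List.prod_nil]
    exact sum_mem fun _ _ => one_mem _
  | succ N ih =>
    rcases l with _ | ⟨⟨p, u, v⟩, l⟩
    · simp at hlen
    simp only [List.map_cons, List.length_cons, Nat.add_right_cancel_iff] at hnd hperm hlen
    -- A factor with equal row and column index splits off as `q b p`. Otherwise it is merged with
    -- the factor whose row index is `v`, and summing over `J v` turns two powers of `X` into one.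
    by_cases huv : u = v
    · subst huv
      have hperm' := List.perm_cons _ |>.1 hperm
      have hu := (List.nodup_cons.1 hnd).1
      refine hdiv ?_
      rw [← sum_eq_smul_sum_update _ u]
      simp only [List.map_cons, List.prod_cons, Function.update_self,
        hupd l u hu (fun h => hu (hperm'.mem_iff.2 h)), ← Finset.sum_mul, ← Finset.mul_sum]
      exact mul_mem (q_mem_adjoin b p) (ih l (List.nodup_cons.1 hnd).2 hperm' hlen)
    · have hv : v ∈ l.map fun t => t.2.1 := by
        have : v ∈ u :: l.map fun t => t.2.1 := hperm.mem_iff.2 List.mem_cons_self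
        exact (List.mem_cons.1 this).resolve_left (Ne.symm huv)
      obtain ⟨⟨p', v', w⟩, ht, hv'⟩ := List.mem_map.1 hv
      obtain rfl : v' = v := hv'
      obtain ⟨l', hl'⟩ : ∃ l', l.Perm ((p', v', w) :: l') := ⟨_, List.perm_cons_erase ht⟩
      have hl1 := hl'.map fun t => t.2.1
      have hl2 := hl'.map fun t => t.2.2
      simp only [List.map_cons] at hl1 hl2
      have hnd1 : (u :: v' :: l'.map fun t => t.2.1).Nodup := (hl1.cons u).nodup_iff.1 hnd
      have hperm1 : (u :: v' :: l'.map fun t => t.2.1).Perm (v' :: w :: l'.map fun t => t.2.2) :=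
        (hl1.cons u).symm.trans (hperm.trans (hl2.cons v'))
      have hnd2 := hperm1.nodup_iff.1 hnd1
      have hperm2 : (u :: l'.map fun t => t.2.1).Perm (w :: l'.map fun t => t.2.2) :=
        (List.perm_cons v').1 ((List.Perm.swap _ _ _).trans hperm1)
      simp only [List.nodup_cons, List.mem_cons, not_or] at hnd1 hnd2
      have hmem : ∑ J : Λ → Fin n, (((p, u, v') :: (p', v', w) :: l').map fun t =>
          (X b ^ t.1) (J t.2.1) (J t.2.2)).prod ∈ S := by
        refine hdiv ?_
        rw [← sum_eq_smul_sum_update _ v']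
        have hih := ih ((p + p', u, w) :: l')
          (by simpa only [List.map_cons, List.nodup_cons] using ⟨hnd1.1.2, hnd1.2.2⟩)
          (by simpa only [List.map_cons] using hperm2)
          (by rw [← hlen, hl'.length_eq, List.length_cons, List.length_cons])
        convert hih using 2 with J
        simp only [List.map_cons, List.prod_cons, Function.update_self,
          hupd l' v' hnd1.2.1 hnd2.1.2, Function.update_of_ne huv,
          Function.update_of_ne (Ne.symm hnd2.1.1), ← mul_assoc, ← Finset.sum_mul]
        rw [pow_add, Matrix.mul_apply]
      -- The reordering is done in the ring of functions of `J`: the sign depends only on the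
      -- exponents, so one sign serves all `J`.
      have hsign := list_prod_eq_or_eq_neg_of_perm
        (a := fun (t : ℕ × Λ × Λ) (J : Λ → Fin n) => (X b ^ t.1) (J t.2.1) (J t.2.2))
        (fun s t => by
          rcases neg_one_pow_eq_or (Ext V) (s.1 * t.1) with h | h
          · refine Or.inl (funext fun J => ?_)
            simp only [Pi.mul_apply]
            rw [mul_comm_of_mem_exteriorPower (X_pow_apply_mem b _ _ _) (X_pow_apply_mem b _ _ _),
              h, one_mul]
          · refine Or.inr (funext fun J => ?_)
            simp only [Pi.mul_apply, Pi.neg_apply]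
            rw [mul_comm_of_mem_exteriorPower (X_pow_apply_mem b _ _ _) (X_pow_apply_mem b _ _ _),
              h, neg_one_mul]) (hl'.cons (p, u, v'))
      have happ (l : List (ℕ × Λ × Λ)) (J : Λ → Fin n) : (l.map
          fun (t : ℕ × Λ × Λ) (J : Λ → Fin n) => (X b ^ t.1) (J t.2.1) (J t.2.2)).prod J =
          (l.map fun t => (X b ^ t.1) (J t.2.1) (J t.2.2)).prod := by
        rw [Pi.list_prod_apply, List.map_map]
        rfl
      rcases hsign with h | h
      · simp only [← happ, h]
        simpa only [happ] using hmem
      · simp only [← happ, h, Pi.neg_apply, Finset.sum_neg_distrib]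
        refine neg_mem ?_
        simpa only [happ] using hmem

end Generators

/-! ### Coordinates on the exterior algebra by determinants -/

section Polarization

open ExteriorAlgebra

variable {M κ : Type*} [AddCommGroup M] [Module ℂ M]

/-- The alternating form `(v_1, …, v_m) ↦ det (φ_k (v_l))`. -/
def detForm {m : ℕ} (φ : Fin m → Module.Dual ℂ M) : M [⋀^Fin m]→ₗ[ℂ] ℂ :=
  Matrix.detRowAlternating.compLinearMap (LinearMap.pi φ)

theorem detForm_apply {m : ℕ} (φ : Fin m → Module.Dual ℂ M) (v : Fin m → M) :
    detForm φ v = (Matrix.of fun l k => φ k (v l)).det := rfl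

theorem detForm_sum_smul [Fintype κ] {m : ℕ} (ψ : κ → Module.Dual ℂ M) (c : Fin m → κ → ℂ)
    (v : Fin m → M) : detForm (fun k => ∑ x, c k x • ψ x) v =
      ∑ w : Fin m → κ, (∏ k, c k (w k)) * detForm (fun k => ψ (w k)) v := by
  have h1 (φ : Fin m → Module.Dual ℂ M) : detForm φ v =
      Matrix.detRowAlternating (R := ℂ) (n := Fin m) fun k l => φ k (v l) := by
    rw [detForm_apply, ← Matrix.det_transpose]
    rfl
  simp only [h1]
  have h2 : (fun k l => (∑ x, c k x • ψ x) (v l)) =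
      fun k => ∑ x, c k x • fun l => ψ x (v l) := by
    ext k l
    simp
  rw [h2]
  have h3 := (Matrix.detRowAlternating (R := ℂ) (n := Fin m)).toMultilinearMap.map_sum
    (fun k x => c k x • fun l => ψ x (v l))
  refine h3.trans (Finset.sum_congr rfl fun w _ => ?_)
  exact MultilinearMap.map_smul_univ _ (fun k => c k (w k)) fun k l => ψ (w k) (v l)

/-- The linear form on the exterior algebra that is `det (φ_k (v_l))` in degree `m` and zero in the
other degrees. -/
def detFunctional {m : ℕ} (φ : Fin m → Module.Dual ℂ M) : ExteriorAlgebra ℂ M →ₗ[ℂ] ℂ :=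
  liftAlternating (Pi.single m (detForm φ))

theorem detFunctional_ιMulti {m : ℕ} (φ : Fin m → Module.Dual ℂ M) (v : Fin m → M) :
    detFunctional φ (ιMulti ℂ m v) = detForm φ v := by
  rw [detFunctional, liftAlternating_apply_ιMulti, Pi.single_eq_same]

theorem detFunctional_ιMulti_of_ne {m k : ℕ} (h : k ≠ m) (φ : Fin m → Module.Dual ℂ M)
    (v : Fin k → M) : detFunctional φ (ιMulti ℂ k v) = 0 := by
  rw [detFunctional, liftAlternating_apply_ιMulti, Pi.single_eq_of_ne h]
  rfl

theorem exteriorAlgebra_lhom_ext {N : Type*} [AddCommGroup N] [Module ℂ N]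
    {f g : ExteriorAlgebra ℂ M →ₗ[ℂ] N}
    (h : ∀ m (v : Fin m → M), f (ιMulti ℂ m v) = g (ιMulti ℂ m v)) : f = g :=
  lhom_ext fun m => AlternatingMap.ext (h m)

theorem detFunctional_map {m : ℕ} (φ : Fin m → Module.Dual ℂ M) (f : M →ₗ[ℂ] M)
    (w : ExteriorAlgebra ℂ M) :
    detFunctional φ (map f w) = detFunctional (fun k => φ k ∘ₗ f) w := by
  have : detFunctional φ ∘ₗ (map f).toLinearMap = detFunctional fun k => φ k ∘ₗ f := by
    refine exteriorAlgebra_lhom_ext fun k v => ?_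
    rw [LinearMap.comp_apply, AlgHom.toLinearMap_apply, map_apply_ιMulti]
    rcases eq_or_ne k m with rfl | hk
    · rw [detFunctional_ιMulti, detFunctional_ιMulti]
      rfl
    · rw [detFunctional_ιMulti_of_ne hk, detFunctional_ιMulti_of_ne hk]
  exact LinearMap.congr_fun this w

theorem detFunctional_sum_smul [Fintype κ] {m : ℕ} (ψ : κ → Module.Dual ℂ M)
    (c : Fin m → κ → ℂ) (x : ExteriorAlgebra ℂ M) :
    detFunctional (fun k => ∑ x, c k x • ψ x) x =
      ∑ w : Fin m → κ, (∏ k, c k (w k)) * detFunctional (fun k => ψ (w k)) x := by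
  have : detFunctional (fun k => ∑ x, c k x • ψ x) =
      ∑ w : Fin m → κ, (∏ k, c k (w k)) • detFunctional fun k => ψ (w k) := by
    refine exteriorAlgebra_lhom_ext fun k v => ?_
    rw [LinearMap.sum_apply]
    simp only [LinearMap.smul_apply]
    rcases eq_or_ne k m with rfl | hk
    · simp only [detFunctional_ιMulti]
      exact detForm_sum_smul ψ c v
    · simp [detFunctional_ιMulti_of_ne hk]
  rw [this, LinearMap.sum_apply]
  rfl

/-- Expand the determinant over permutations. By antisymmetry each one contributes a full copy of
`ιMulti ℂ m v`, whence the factorial. -/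
theorem sum_detForm_smul_ιMulti [Fintype κ] (B : Module.Basis κ ℂ M) {m : ℕ} (v : Fin m → M) :
    ∑ w : Fin m → κ, detForm (fun k => B.coord (w k)) v • ιMulti ℂ m (fun k => B (w k)) =
      (m.factorial : ℂ) • ιMulti ℂ m v := by
  have h1 (u : Fin m → M) : ιMulti ℂ m u =
      ∑ w : Fin m → κ, (∏ k, B.coord (w k) (u k)) • ιMulti ℂ m (fun k => B (w k)) := by
    have hu : u = fun k => ∑ x, B.coord x (u k) • B x := by
      ext k
      exact (B.sum_repr (u k)).symm
    conv_lhs => rw [hu]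
    have h3 := (ιMulti ℂ m (M := M)).toMultilinearMap.map_sum
      (fun k x => B.coord x (u k) • B x)
    refine h3.trans (Finset.sum_congr rfl fun w _ => ?_)
    exact MultilinearMap.map_smul_univ _ (fun k => B.coord (w k) (u k)) fun k => B (w k)
  simp only [detForm_apply, Matrix.det_apply, Finset.sum_smul]
  rw [Finset.sum_comm]
  have h2 (σ : Equiv.Perm (Fin m)) : ∑ w : Fin m → κ, (Equiv.Perm.sign σ •
      ∏ k, Matrix.of (fun l k => B.coord (w k) (v l)) (σ k) k) • ιMulti ℂ m (fun k => B (w k)) =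
      ιMulti ℂ m v := by
    have h3 := h1 (v ∘ σ)
    rw [AlternatingMap.map_perm] at h3
    simp only [smul_assoc, ← Finset.smul_sum]
    change Equiv.Perm.sign σ • ∑ w : Fin m → κ, (∏ k, B.coord (w k) ((v ∘ σ) k)) •
      ιMulti ℂ m (fun k => B (w k)) = _
    rw [← h3, smul_smul, Int.units_mul_self, one_smul]
  rw [Finset.sum_congr rfl fun σ _ => h2 σ, Finset.sum_const, Finset.card_univ, Fintype.card_perm,
    Fintype.card_fin, Nat.cast_smul_eq_nsmul]

/-- Each element of the exterior algebra is recovered from its coordinates in all degrees. -/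
theorem exists_eq_sum_detFunctional_smul [Fintype κ] (B : Module.Basis κ ℂ M)
    (x : ExteriorAlgebra ℂ M) : ∃ N : ℕ, x = ∑ m ∈ Finset.range N, (m.factorial : ℂ)⁻¹ •
      ∑ w : Fin m → κ, detFunctional (fun k => B.coord (w k)) x •
        ιMulti ℂ m (fun k => B (w k)) := by
  -- Validity for all large `N` lets the bounds of two summands be merged.
  suffices h : ∃ N₀ : ℕ, ∀ N ≥ N₀, x = ∑ m ∈ Finset.range N, (m.factorial : ℂ)⁻¹ •
      ∑ w : Fin m → κ, detFunctional (fun k => B.coord (w k)) x •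
        ιMulti ℂ m (fun k => B (w k)) from
    h.imp fun N hN => hN N le_rfl
  have hx : x ∈ Submodule.span ℂ
      (Set.range fun x : Σ n, (Fin n → M) => ιMulti ℂ x.1 x.2) := by
    rw [ιMulti_span]
    trivial
  induction hx using Submodule.span_induction with
  | mem x hx =>
    obtain ⟨⟨k, v⟩, rfl⟩ := hx
    refine ⟨k + 1, fun N hN => ?_⟩
    rw [Finset.sum_eq_single k]
    · simp only [detFunctional_ιMulti]
      rw [sum_detForm_smul_ιMulti, smul_smul,
        inv_mul_cancel₀ (Nat.cast_ne_zero.2 k.factorial_ne_zero), one_smul]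
    · intro m _ hm
      simp [detFunctional_ιMulti_of_ne hm.symm]
    · intro h
      exact absurd (Finset.mem_range.2 hN) h
  | zero => exact ⟨0, by simp⟩
  | add x y _ _ hx hy =>
    obtain ⟨N₁, h₁⟩ := hx
    obtain ⟨N₂, h₂⟩ := hy
    refine ⟨max N₁ N₂, fun N hN => ?_⟩
    simp only [map_add, add_smul, Finset.sum_add_distrib, smul_add]
    rw [← h₁ N (le_trans (le_max_left _ _) hN), ← h₂ N (le_trans (le_max_right _ _) hN)]
  | smul c x _ hx =>
    obtain ⟨N₁, h₁⟩ := hx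
    refine ⟨N₁, fun N hN => ?_⟩
    simp only [map_smul, smul_eq_mul, mul_smul, ← Finset.smul_sum]
    simp only [smul_comm _ c, ← Finset.smul_sum]
    rw [← h₁ N hN]

end Polarization

/-! ### Generation of the invariants by the traces -/

section FirstFundamentalTheorem

theorem tensorPowMatrix_mul {ι κ : Type*} [Fintype ι] [DecidableEq ι] [Fintype κ]
    (G H : Matrix κ κ ℂ) :
    tensorPowMatrix (ι := ι) (G * H) = tensorPowMatrix G * tensorPowMatrix H := by
  ext I J
  simp only [tensorPowMatrix, Matrix.of_apply, Matrix.mul_apply, Finset.prod_univ_sum,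
    Fintype.piFinset_univ, Finset.prod_mul_distrib]

theorem tensorPowMatrix_one {ι κ : Type*} [Fintype ι] [DecidableEq κ] :
    tensorPowMatrix (1 : Matrix κ κ ℂ) = (1 : Matrix (ι → κ) (ι → κ) ℂ) := by
  classical
  ext I J
  simp only [tensorPowMatrix, Matrix.of_apply, Matrix.one_apply, Finset.prod_ite_zero,
    Finset.prod_const_one, Finset.mem_univ, true_imp_iff, funext_iff]

variable {V : Type*} [AddCommGroup V] [Module ℂ V] {n : ℕ} (b : Module.Basis (Fin n) ℂ V)

/-- The basis `e_i ⊗ e_j^*` of `V ⊗ V*`. -/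
noncomputable def tensorBasis : Module.Basis (Fin n × Fin n) ℂ (V ⊗[ℂ] Module.Dual ℂ V) :=
  b.tensorProduct b.dualBasis

theorem tensorBasis_apply (x : Fin n × Fin n) : tensorBasis b x = b x.1 ⊗ₜ b.coord x.2 := by
  rw [tensorBasis, Module.Basis.tensorProduct_apply', Module.Basis.coe_dualBasis]

theorem tensorBasis_coord_tmul (x : Fin n × Fin n) (v : V) (f : Module.Dual ℂ V) :
    (tensorBasis b).coord x (v ⊗ₜ f) = b.repr v x.1 * f (b x.2) := by
  rw [tensorBasis, Module.Basis.coord_apply, Module.Basis.tensorProduct_repr_tmul_apply,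
    Module.Basis.dualBasis_repr, smul_eq_mul, mul_comm]

theorem ι_tensorBasis (x : Fin n × Fin n) :
    ExteriorAlgebra.ι ℂ (tensorBasis b x) = X b x.1 x.2 := by
  rw [tensorBasis_apply]
  rfl

/-- The matrix of an element of `GL(V)`. -/
noncomputable def glMatrix : LinearMap.GeneralLinearGroup ℂ V ≃* GL (Fin n) ℂ :=
  Units.mapEquiv (LinearMap.toMatrixAlgEquiv b).toMulEquiv

theorem repr_glMatrix (g : LinearMap.GeneralLinearGroup ℂ V) (v : V) (i : Fin n) :
    b.repr ((g : V →ₗ[ℂ] V) v) i =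
      ∑ j, (glMatrix b g : Matrix (Fin n) (Fin n) ℂ) i j * b.repr v j := by
  have h := LinearMap.toMatrix_mulVec_repr b b (g : V →ₗ[ℂ] V) v
  exact (congrFun h i).symm

theorem tensorBasis_coord_comp_tensorDualRep (g : LinearMap.GeneralLinearGroup ℂ V)
    (y : Fin n × Fin n) :
    (tensorBasis b).coord y ∘ₗ tensorDualRep V g =
      ∑ x : Fin n × Fin n, ((glMatrix b g : Matrix (Fin n) (Fin n) ℂ) y.1 x.1 *
        (glMatrix b g⁻¹ : Matrix (Fin n) (Fin n) ℂ) x.2 y.2) • (tensorBasis b).coord x := by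
  refine TensorProduct.ext' fun v f => ?_
  have h1 : (tensorDualRep V g) (v ⊗ₜ f) = (g : V →ₗ[ℂ] V) v ⊗ₜ (f ∘ₗ ((g⁻¹ : _) : V →ₗ[ℂ] V)) :=
    rfl
  have h2 : f (((g⁻¹ : _) : V →ₗ[ℂ] V) (b y.2)) =
      ∑ j, (glMatrix b g⁻¹ : Matrix (Fin n) (Fin n) ℂ) j y.2 * f (b j) := by
    conv_lhs => rw [← b.sum_repr (((g⁻¹ : _) : V →ₗ[ℂ] V) (b y.2))]
    rw [map_sum]
    refine Finset.sum_congr rfl fun j _ => ?_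
    rw [map_smul, smul_eq_mul, repr_glMatrix, Finset.sum_eq_single y.2]
    · rw [b.repr_self, Finsupp.single_eq_same, mul_one]
    · intro k _ hk
      rw [b.repr_self, Finsupp.single_eq_of_ne hk, mul_zero]
    · simp
  rw [LinearMap.comp_apply, h1, tensorBasis_coord_tmul, LinearMap.comp_apply, h2, repr_glMatrix,
    LinearMap.sum_apply, Fintype.sum_prod_type, Finset.sum_mul_sum]
  refine Finset.sum_congr rfl fun i _ => Finset.sum_congr rfl fun j _ => ?_
  rw [LinearMap.smul_apply, tensorBasis_coord_tmul, smul_eq_mul]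
  ring

/-- The matrix of the coordinates of degree `m` of an element of `Λ(V ⊗ V*)`. -/
noncomputable def coordMatrix (m : ℕ) (x : Ext V) : Matrix (Fin m → Fin n) (Fin m → Fin n) ℂ :=
  Matrix.of fun I J => detFunctional (fun k => (tensorBasis b).coord (I k, J k)) x

theorem sum_arrow_prod {E ι κ : Type*} [Fintype ι] [DecidableEq ι] [Fintype κ] [AddCommMonoid E]
    (F : (ι → κ × κ) → E) : ∑ w, F w = ∑ I : ι → κ, ∑ J : ι → κ, F fun k => (I k, J k) := by
  rw [← Fintype.sum_prod_type']
  exact Fintype.sum_equiv (Equiv.arrowProdEquivProdArrow ι (fun _ => κ) (fun _ => κ)) _ _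
    fun _ => rfl

/-- Row indices transform by `g` and column indices by `g⁻¹`, so the action becomes conjugation by
the tensor power and invariance becomes commutation. -/
theorem coordMatrix_extAction (m : ℕ) (g : LinearMap.GeneralLinearGroup ℂ V) (x : Ext V) :
    coordMatrix b m (extAction V g x) =
      tensorPowMatrix (glMatrix b g : Matrix (Fin n) (Fin n) ℂ) * coordMatrix b m x *
        tensorPowMatrix (glMatrix b g⁻¹ : Matrix (Fin n) (Fin n) ℂ) := by
  ext I J
  have h1 : coordMatrix b m (extAction V g x) I J =
      detFunctional (fun k => (tensorBasis b).coord (I k, J k) ∘ₗ tensorDualRep V g) x :=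
    detFunctional_map _ _ _
  rw [h1]
  simp only [tensorBasis_coord_comp_tensorDualRep]
  rw [detFunctional_sum_smul (tensorBasis b).coord (fun k x =>
    (glMatrix b g : Matrix (Fin n) (Fin n) ℂ) (I k) x.1 *
      (glMatrix b g⁻¹ : Matrix (Fin n) (Fin n) ℂ) x.2 (J k)), sum_arrow_prod, Finset.sum_comm]
  simp only [Matrix.mul_apply, Finset.sum_mul, tensorPowMatrix, coordMatrix, Matrix.of_apply,
    Finset.prod_mul_distrib]
  refine Finset.sum_congr rfl fun I' _ => Finset.sum_congr rfl fun J' _ => ?_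
  ring

theorem coordMatrix_commute (m : ℕ) {x : Ext V} (hx : x ∈ invariants V) (g : GL (Fin n) ℂ) :
    coordMatrix b m x * tensorPowMatrix (g : Matrix (Fin n) (Fin n) ℂ) =
      tensorPowMatrix g * coordMatrix b m x := by
  obtain ⟨g, rfl⟩ := (glMatrix b).surjective g
  have h := coordMatrix_extAction b m g x
  rw [hx g] at h
  conv_lhs => rw [h]
  rw [mul_assoc, ← tensorPowMatrix_mul, ← Units.val_mul, ← map_mul, inv_mul_cancel, map_one,
    Units.val_one, tensorPowMatrix_one, mul_one]

theorem ιMulti_tensorBasis {m : ℕ} (I J : Fin m → Fin n) :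
    ExteriorAlgebra.ιMulti ℂ m (fun k => tensorBasis b (I k, J k)) =
      ((List.finRange m).map fun k => X b (I k) (J k)).prod := by
  rw [ExteriorAlgebra.ιMulti_apply, List.ofFn_eq_map]
  simp only [ι_tensorBasis]

theorem sum_ιMulti_perm_mem_adjoin {m : ℕ} (σ : Equiv.Perm (Fin m)) :
    ∑ I : Fin m → Fin n, ((List.finRange m).map fun k => X b (I k) (I (σ k))).prod ∈
      Algebra.adjoin ℂ (Set.range fun i : Fin n => q b (2 * (i : ℕ) + 1)) := by
  have h := sum_prod_X_pow_mem_adjoin b ((List.finRange m).map fun k => (1, k, σ k))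
    (by simpa [List.map_map, Function.comp_def] using List.nodup_finRange m)
    (by simpa [List.map_map, Function.comp_def] using (Equiv.Perm.map_finRange_perm σ).symm)
  simpa only [List.map_map, Function.comp_def, pow_one] using h

/-- First fundamental theorem for the invariants of `GL(V)` in `Λ(V ⊗ V*)`. -/
theorem invariants_le_adjoin : invariants V ≤
    Algebra.adjoin ℂ (Set.range fun i : Fin n => q b (2 * (i : ℕ) + 1)) := by
  intro x hx
  obtain ⟨N, hN⟩ := exists_eq_sum_detFunctional_smul (tensorBasis b) x
  rw [hN]
  refine sum_mem fun m _ => Subalgebra.smul_mem _ ?_ _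
  obtain ⟨c, hc⟩ := exists_eq_sum_perm_of_commute_tensorPowMatrix _ (coordMatrix_commute b m hx)
  rw [sum_arrow_prod]
  have h1 (I J : Fin m → Fin n) : detFunctional (fun k => (tensorBasis b).coord (I k, J k)) x =
      ∑ σ : Equiv.Perm (Fin m), c σ * if I ∘ σ = J then 1 else 0 := hc I J
  -- A permutation matrix leaves only `J = I ∘ σ`, so every index occurs once as a row and once as a
  -- column.
  have h2 : ∑ I : Fin m → Fin n, ∑ J : Fin m → Fin n,
      detFunctional (fun k => (tensorBasis b).coord (I k, J k)) x •
        ExteriorAlgebra.ιMulti ℂ m (fun k => tensorBasis b (I k, J k)) =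
      ∑ σ : Equiv.Perm (Fin m), c σ •
        ∑ I : Fin m → Fin n, ((List.finRange m).map fun k => X b (I k) (I (σ k))).prod := by
    simp only [h1, ιMulti_tensorBasis, Finset.smul_sum]
    rw [Finset.sum_comm (s := Finset.univ (α := Equiv.Perm (Fin m)))]
    refine Finset.sum_congr rfl fun I _ => ?_
    simp only [Finset.sum_smul]
    rw [Finset.sum_comm]
    refine Finset.sum_congr rfl fun σ _ => ?_
    rw [Finset.sum_eq_single (I ∘ σ)]
    · simp
    · intro J _ hJ
      rw [if_neg hJ.symm, mul_zero, zero_smul]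
    · simp
  rw [h2]
  exact sum_mem fun σ _ => Subalgebra.smul_mem _ (sum_ιMulti_perm_mem_adjoin b σ) _

end FirstFundamentalTheorem

/-! ### The invariant top form and linear independence -/

section TopDegree

theorem alternatingMap_eq_det_smul {M N : Type*} [AddCommGroup M] [Module ℂ M] [AddCommGroup N]
    [Module ℂ N] {m : ℕ} (B : Module.Basis (Fin m) ℂ M) (f : M [⋀^Fin m]→ₗ[ℂ] N)
    (v : Fin m → M) : f v = B.det v • f B := by
  suffices h : f = (LinearMap.toSpanSingleton ℂ N (f B)).compAlternatingMap B.det from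
    congrArg (fun g : M [⋀^Fin m]→ₗ[ℂ] N => g v) h
  refine Module.Basis.ext_alternating B fun v hv => ?_
  let σ : Equiv.Perm (Fin m) := Equiv.ofBijective v (Finite.injective_iff_bijective.1 hv)
  have hσ : (fun i => B (v i)) = B ∘ σ := rfl
  rw [hσ, AlternatingMap.map_perm, AlternatingMap.map_perm, LinearMap.compAlternatingMap_apply,
    B.det_self, LinearMap.toSpanSingleton_apply, one_smul]

theorem detFunctional_eq_zero_of_mem {M : Type*} [AddCommGroup M] [Module ℂ M] {m k : ℕ}
    (h : k ≠ m) (φ : Fin m → Module.Dual ℂ M) {x : ExteriorAlgebra ℂ M} (hx : x ∈ ⋀[ℂ]^k M) :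
    detFunctional φ x = 0 := by
  rw [← ExteriorAlgebra.ιMulti_span_fixedDegree] at hx
  induction hx using Submodule.span_induction with
  | mem x hx =>
    obtain ⟨v, rfl⟩ := hx
    exact detFunctional_ιMulti_of_ne h φ v
  | zero => exact map_zero _
  | add x y _ _ hx hy => rw [map_add, hx, hy, add_zero]
  | smul c x _ hx => rw [map_smul, hx, smul_zero]

variable {V : Type*} [AddCommGroup V] [Module ℂ V] {n : ℕ} (b : Module.Basis (Fin n) ℂ V)

theorem tensorDualRep_tensorBasis (g : LinearMap.GeneralLinearGroup ℂ V) (x : Fin n × Fin n) :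
    tensorDualRep V g (tensorBasis b x) =
      ∑ y : Fin n × Fin n, ((glMatrix b g : Matrix (Fin n) (Fin n) ℂ) y.1 x.1 *
        (glMatrix b g⁻¹ : Matrix (Fin n) (Fin n) ℂ) x.2 y.2) • tensorBasis b y := by
  conv_lhs => rw [← (tensorBasis b).sum_repr (tensorDualRep V g (tensorBasis b x))]
  refine Finset.sum_congr rfl fun y _ => ?_
  have h := LinearMap.congr_fun (tensorBasis_coord_comp_tensorDualRep b g y) (tensorBasis b x)
  rw [LinearMap.comp_apply, Module.Basis.coord_apply, LinearMap.sum_apply,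
    Finset.sum_eq_single x] at h
  · rw [h, LinearMap.smul_apply, Module.Basis.coord_apply, Module.Basis.repr_self,
      Finsupp.single_eq_same, smul_eq_mul, mul_one]
  · intro z _ hz
    rw [LinearMap.smul_apply, Module.Basis.coord_apply, Module.Basis.repr_self,
      Finsupp.single_eq_of_ne hz, smul_zero]
  · simp

/-- The matrix is the Kronecker product of `g` and the transpose of `g⁻¹`, whose determinants enter
with the same exponent `n` and cancel. -/
theorem det_tensorDualRep {V : Type*} [AddCommGroup V] [Module ℂ V] {n : ℕ}
    (b : Module.Basis (Fin n) ℂ V) (g : LinearMap.GeneralLinearGroup ℂ V) :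
    LinearMap.det (tensorDualRep V g) = 1 := by
  have h : LinearMap.toMatrix (tensorBasis b) (tensorBasis b) (tensorDualRep V g) =
      Matrix.kronecker (glMatrix b g : Matrix (Fin n) (Fin n) ℂ)
        (glMatrix b g⁻¹ : Matrix (Fin n) (Fin n) ℂ).transpose := by
    ext y x
    rw [LinearMap.toMatrix_apply, tensorDualRep_tensorBasis, map_sum, Finsupp.finsetSum_apply,
      Finset.sum_eq_single y]
    · rw [map_smul, Module.Basis.repr_self, Finsupp.smul_apply, Finsupp.single_eq_same,
        smul_eq_mul, mul_one]
      rfl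
    · intro z _ hz
      rw [map_smul, Module.Basis.repr_self, Finsupp.smul_apply, Finsupp.single_eq_of_ne hz.symm,
        smul_zero]
    · simp
  rw [← LinearMap.det_toMatrix (tensorBasis b), h, Matrix.kronecker, Matrix.det_kronecker, Matrix.det_transpose,
    ← mul_pow, ← Matrix.det_mul, ← Units.val_mul, ← map_mul, mul_inv_cancel, map_one,
    Units.val_one, Matrix.det_one, one_pow]

theorem extAction_X (g : LinearMap.GeneralLinearGroup ℂ V) (i j : Fin n) :
    extAction V g (X b i j) =
      ∑ k, ∑ l, ((glMatrix b g : Matrix (Fin n) (Fin n) ℂ) k i *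
        (glMatrix b g⁻¹ : Matrix (Fin n) (Fin n) ℂ) j l) • X b k l := by
  have h1 := ι_tensorBasis b (i, j)
  have h2 : extAction V g (ExteriorAlgebra.ι ℂ (tensorBasis b (i, j))) =
      ExteriorAlgebra.ι ℂ (tensorDualRep V g (tensorBasis b (i, j))) :=
    ExteriorAlgebra.map_apply_ι _ _
  rw [← h1, h2, tensorDualRep_tensorBasis, map_sum, Fintype.sum_prod_type]
  simp only [map_smul, ι_tensorBasis]

theorem trace_map_algebraMap_mul {R A ι : Type*} [CommSemiring R] [Semiring A] [Algebra R A]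
    [Fintype ι] (P : Matrix ι ι R) (Y : Matrix ι ι A) :
    (P.map (algebraMap R A) * Y).trace = (Y * P.map (algebraMap R A)).trace := by
  simp only [Matrix.trace, Matrix.diag_apply, Matrix.mul_apply, Matrix.map_apply]
  rw [Finset.sum_comm]
  exact Finset.sum_congr rfl fun i _ => Finset.sum_congr rfl fun j _ => Algebra.commutes _ _

/-- The action conjugates `X` by a scalar matrix. Scalars are central, so for these matrices the
trace is cyclic despite the noncommutative entries. -/
theorem q_mem_invariants (k : ℕ) : q b k ∈ invariants V := by
  intro g
  let P := (glMatrix b g : Matrix (Fin n) (Fin n) ℂ).transpose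
  let Q := (glMatrix b g⁻¹ : Matrix (Fin n) (Fin n) ℂ).transpose
  let P' : Matrix (Fin n) (Fin n) (Ext V) := P.map (algebraMap ℂ (Ext V))
  let Q' : Matrix (Fin n) (Fin n) (Ext V) := Q.map (algebraMap ℂ (Ext V))
  have hQP : Q' * P' = 1 := by
    have : Q * P = 1 := by
      rw [← Matrix.transpose_mul, ← Units.val_mul, ← map_mul, mul_inv_cancel, map_one,
        Units.val_one, Matrix.transpose_one]
    rw [← Matrix.map_mul, this, Matrix.map_one _ (map_zero _) (map_one _)]
  have hX : (extAction V g).toRingHom.mapMatrix (X b) = P' * X b * Q' := by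
    ext i j
    have h1 : (extAction V g).toRingHom.mapMatrix (X b) i j = extAction V g (X b i j) := rfl
    rw [h1, extAction_X, Finset.sum_comm]
    simp only [Matrix.mul_apply, Finset.sum_mul]
    refine Finset.sum_congr rfl fun l _ => Finset.sum_congr rfl fun k _ => ?_
    change _ = algebraMap ℂ (Ext V) _ * X b k l * algebraMap ℂ (Ext V) _
    rw [mul_assoc, ← Algebra.commutes, ← mul_assoc, ← map_mul, ← Algebra.smul_def]
    rfl
  have hpow : (P' * X b * Q') ^ k = P' * (X b ^ k * Q') := by
    have hPQ : P' * Q' = 1 := by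
      have : P * Q = 1 := by
        rw [← Matrix.transpose_mul, ← Units.val_mul, ← map_mul, inv_mul_cancel, map_one,
          Units.val_one, Matrix.transpose_one]
      rw [← Matrix.map_mul, this, Matrix.map_one _ (map_zero _) (map_one _)]
    induction k with
    | zero => rw [pow_zero, pow_zero, one_mul, hPQ]
    | succ k ih =>
      rw [pow_succ, ih, pow_succ]
      calc P' * (X b ^ k * Q') * (P' * X b * Q') = P' * (X b ^ k * ((Q' * P') * (X b * Q'))) := by
            simp only [mul_assoc]
        _ = P' * (X b ^ k * X b * Q') := by rw [hQP, one_mul, mul_assoc]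
  have h1 : extAction V g (q b k) = ((extAction V g).toRingHom.mapMatrix (X b ^ k)).trace :=
    AddMonoidHom.map_trace (extAction V g).toRingHom.toAddMonoidHom _
  rw [h1, map_pow, hX, hpow, trace_map_algebraMap_mul, mul_assoc]
  change (X b ^ k * (Q' * P')).trace = _
  rw [hQP, mul_one]
  rfl

theorem adjoin_q_eq_invariants :
    Algebra.adjoin ℂ (Set.range fun i : Fin n => q b (2 * (i : ℕ) + 1)) = invariants V := by
  refine le_antisymm (Algebra.adjoin_le ?_) (invariants_le_adjoin b)
  rintro _ ⟨i, rfl⟩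
  exact q_mem_invariants b _

theorem qProd_eq_sortedProd :
    qProd b = sortedProd fun i : Fin n => q b (2 * (i : ℕ) + 1) := by
  funext S
  simp only [qProd, sortedProd, List.pure_def, List.bind_eq_flatMap, ← List.map_eq_flatMap,
    List.map_map, Function.comp_def]

theorem qProd_mem (S : Finset (Fin n)) :
    qProd b S ∈ ⋀[ℂ]^(∑ i ∈ S, (2 * (i : ℕ) + 1)) (V ⊗[ℂ] Module.Dual ℂ V) := by
  have h := SetLike.list_prod_map_mem_graded
    (A := fun i : ℕ => ⋀[ℂ]^i (V ⊗[ℂ] Module.Dual ℂ V)) (S.sort (· ≤ ·))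
    (fun i : Fin n => 2 * (i : ℕ) + 1) (fun i => q b (2 * (i : ℕ) + 1)) fun i _ => q_mem b _
  rw [← List.sum_toFinset _ (Finset.sort_nodup _ _), Finset.sort_toFinset] at h
  rw [qProd_eq_sortedProd]
  exact h

theorem sum_fin_odd (n : ℕ) : ∑ i : Fin n, (2 * (i : ℕ) + 1) = n * n := by
  rw [Fin.sum_univ_eq_sum_range (fun i => 2 * i + 1) n]
  induction n with
  | zero => rfl
  | succ n ih => rw [Finset.sum_range_succ, ih]; ring

/-- The top form lies in the span of the ordered products, so its coordinate `D` is nonzero on one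
of them. `D` vanishes outside degree `n * n`, and a proper subset of the generators has smaller
total degree. -/
theorem qProd_univ_ne_zero : qProd b Finset.univ ≠ 0 := by
  let B := (tensorBasis b).reindex finProdFinEquiv
  let top : Ext V := ExteriorAlgebra.ιMulti ℂ (n * n) B
  let D := detFunctional (fun k => B.coord k)
  have hD : D top = 1 := by
    change detFunctional _ _ = _
    rw [detFunctional_ιMulti, detForm_apply]
    convert Matrix.det_one (R := ℂ) (n := Fin (n * n)) using 2
    ext i j
    rw [Matrix.of_apply, Module.Basis.coord_apply, Module.Basis.repr_self, Matrix.one_apply,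
      Finsupp.single_apply]
  have htop : top ∈ invariants V := by
    intro g
    have h1 : extAction V g top = ExteriorAlgebra.ιMulti ℂ (n * n) (tensorDualRep V g ∘ B) :=
      ExteriorAlgebra.map_apply_ιMulti _ _
    rw [h1, alternatingMap_eq_det_smul B, Module.Basis.det_comp, B.det_self,
      det_tensorDualRep b g, one_mul, one_smul]
  have hspan : top ∈ Submodule.span ℂ (Set.range (qProd b)) := by
    rw [qProd_eq_sortedProd]
    rw [← adjoin_q_eq_invariants b] at htop
    have := adjoin_range_eq_span_sortedProd (a := fun i : Fin n => q b (2 * (i : ℕ) + 1))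
      fun i j => q_anticomm b i j
    exact this.le htop
  obtain ⟨S, hS⟩ : ∃ S, D (qProd b S) ≠ 0 := by
    by_contra! hcon
    have : Submodule.span ℂ (Set.range (qProd b)) ≤ LinearMap.ker D :=
      Submodule.span_le.2 (by rintro _ ⟨S, rfl⟩; exact hcon S)
    exact one_ne_zero (hD.symm.trans (this hspan))
  have hdeg : ∑ i ∈ S, (2 * (i : ℕ) + 1) = n * n := by
    by_contra hne
    exact hS (detFunctional_eq_zero_of_mem hne _ (qProd_mem b S))
  have huniv : ∑ i : Fin n, (2 * (i : ℕ) + 1) = n * n := by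
    exact sum_fin_odd n
  have hSuniv : S = Finset.univ := by
    by_contra hne
    obtain ⟨i, hi⟩ : ∃ i, i ∉ S := by
      by_contra! h
      exact hne (Finset.eq_univ_of_forall h)
    have := Finset.sum_lt_sum_of_subset (f := fun i : Fin n => 2 * (i : ℕ) + 1)
      (Finset.subset_univ S) (Finset.mem_univ i) hi (Nat.succ_pos _) fun _ _ _ => Nat.zero_le _
    rw [huniv, hdeg] at this
    exact lt_irrefl _ this
  intro h
  rw [hSuniv, h, map_zero] at hS
  exact hS rfl

theorem linearIndependent_qProd : LinearIndependent ℂ (qProd b) := by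
  rw [qProd_eq_sortedProd]
  refine linearIndependent_sortedProd (fun i j => q_anticomm b i j) ?_
  rw [← qProd_eq_sortedProd]
  exact qProd_univ_ne_zero b

end TopDegree

/-! ### Presentation and the exterior algebra isomorphism -/

section Relations

theorem map_sortedProd {ι A C : Type*} [LinearOrder ι] [Ring A] [Algebra ℂ A] [Ring C]
    [Algebra ℂ C] (ψ : A →ₐ[ℂ] C) (a : ι → A) (S : Finset ι) :
    ψ (sortedProd a S) = sortedProd (ψ ∘ a) S := by
  rw [sortedProd, map_list_prod, List.map_map]
  rfl

/-- Ordered products span the source, and independence of their images forces every coefficient to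
vanish. -/
theorem eq_zero_of_map_eq_zero_of_anticomm {ι A C : Type*} [Fintype ι] [LinearOrder ι] [Ring A]
    [Algebra ℂ A] [Ring C] [Algebra ℂ C] (ψ : A →ₐ[ℂ] C) {a : ι → A}
    (ha : ∀ i j, a i * a j = -(a j * a i)) (hli : LinearIndependent ℂ (sortedProd (ψ ∘ a)))
    {x : A} (hx : x ∈ Algebra.adjoin ℂ (Set.range a)) (h : ψ x = 0) : x = 0 := by
  have hx' : x ∈ Submodule.span ℂ (Set.range (sortedProd a)) :=
    (adjoin_range_eq_span_sortedProd ha).le hx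
  obtain ⟨c, rfl⟩ := (Submodule.mem_span_range_iff_exists_fun ℂ).1 hx'
  simp only [map_sum, map_smul, map_sortedProd] at h
  have hc := Fintype.linearIndependent_iff.1 hli c h
  simp [hc]

variable {V : Type*} [AddCommGroup V] [Module ℂ V] {n : ℕ} (b : Module.Basis (Fin n) ℂ V)

theorem anticommIdeal_le_ker : anticommIdeal n ≤ TwoSidedIdeal.ker (qHom b) := by
  refine TwoSidedIdeal.span_le.2 ?_
  rintro _ ⟨i, j, rfl⟩
  rw [SetLike.mem_coe, TwoSidedIdeal.mem_ker]
  simp only [qHom, map_add, map_mul, FreeAlgebra.lift_ι_apply]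
  rw [q_anticomm b i j, neg_add_cancel]

theorem ker_qHom : TwoSidedIdeal.ker (qHom b) = anticommIdeal n := by
  refine le_antisymm (fun x hx => ?_) (anticommIdeal_le_ker b)
  let π : FreeAlgebra ℂ (Fin n) →ₐ[ℂ] (anticommIdeal n).ringCon.Quotient :=
    (anticommIdeal n).ringCon.mkₐ (α := ℂ)
  have hπ (y : FreeAlgebra ℂ (Fin n)) : π y = 0 ↔ y ∈ anticommIdeal n := by
    conv_rhs => rw [← TwoSidedIdeal.ker_ringCon_mk' (anticommIdeal n), TwoSidedIdeal.mem_ker]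
    rfl
  let a : Fin n → (anticommIdeal n).ringCon.Quotient := π ∘ FreeAlgebra.ι ℂ
  have ha (i j : Fin n) : a i * a j = -(a j * a i) := by
    rw [eq_neg_iff_add_eq_zero]
    have := (hπ _).2 (TwoSidedIdeal.subset_span
      ⟨i, j, rfl⟩ : FreeAlgebra.ι ℂ i * FreeAlgebra.ι ℂ j +
        FreeAlgebra.ι ℂ j * FreeAlgebra.ι ℂ i ∈ anticommIdeal n)
    rwa [map_add, map_mul, map_mul] at this
  have hmem : π x ∈ Submodule.span ℂ (Set.range (sortedProd a)) := by
    rw [← adjoin_range_eq_span_sortedProd ha, Set.range_comp, ← AlgHom.map_adjoin,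
      FreeAlgebra.adjoin_range_ι]
    exact ⟨x, trivial, rfl⟩
  obtain ⟨c, hc⟩ := (Submodule.mem_span_range_iff_exists_fun ℂ).1 hmem
  -- Modulo anticommutators, `x` is a combination of ordered monomials. Applying `qHom b` turns this
  -- into a relation among the independent `qProd b S`.
  have hdiff : ∑ S, c S • sortedProd (FreeAlgebra.ι ℂ) S - x ∈ anticommIdeal n := by
    rw [← hπ, map_sub, map_sum, sub_eq_zero, ← hc]
    simp only [map_smul, map_sortedProd]
    rfl
  have hker := TwoSidedIdeal.mem_ker _ |>.1 (anticommIdeal_le_ker b hdiff)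
  rw [map_sub, TwoSidedIdeal.mem_ker _ |>.1 hx, sub_zero, map_sum] at hker
  have hq : qHom b ∘ FreeAlgebra.ι ℂ = fun i : Fin n => q b (2 * (i : ℕ) + 1) :=
    FreeAlgebra.ι_comp_lift _
  simp only [map_smul, map_sortedProd, hq, ← qProd_eq_sortedProd] at hker
  have hc0 := Fintype.linearIndependent_iff.1 (linearIndependent_qProd b) c hker
  rw [← hπ, ← hc]
  simp [hc0]

/-- The homomorphism from the exterior algebra on `ℂⁿ` that sends the `i`-th basis vector to
`q_{2 i + 1}`. -/
noncomputable def qExtHom : ExteriorAlgebra ℂ (Fin n → ℂ) →ₐ[ℂ] Ext V :=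
  ExteriorAlgebra.lift ℂ ⟨Fintype.linearCombination ℂ fun i : Fin n => q b (2 * (i : ℕ) + 1),
    fun m => by
      set s := Fintype.linearCombination ℂ (fun i : Fin n => q b (2 * (i : ℕ) + 1)) m with hs
      have h : s * s = -(s * s) := by
        rw [hs, Fintype.linearCombination_apply, Finset.sum_mul_sum, ← Finset.sum_neg_distrib]
        simp only [← Finset.sum_neg_distrib]
        rw [Finset.sum_comm]
        refine Finset.sum_congr rfl fun i _ => Finset.sum_congr rfl fun j _ => ?_
        rw [smul_mul_smul_comm, smul_mul_smul_comm, q_anticomm b j i, smul_neg, mul_comm]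
      exact mul_self_eq_zero_of_anticomm (a := fun _ : Unit => s) (fun _ _ => h) ()⟩

theorem qExtHom_single (i : Fin n) :
    qExtHom b (ExteriorAlgebra.ι ℂ (Pi.single i 1)) = q b (2 * (i : ℕ) + 1) := by
  rw [qExtHom, ExteriorAlgebra.lift_ι_apply, Fintype.linearCombination_apply_single, one_smul]

theorem adjoin_ι_single (n : ℕ) : Algebra.adjoin ℂ (Set.range fun i : Fin n =>
    ExteriorAlgebra.ι ℂ (Pi.single i 1 : Fin n → ℂ)) = ⊤ := by
  rw [eq_top_iff, ← CliffordAlgebra.adjoin_range_ι]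
  refine Algebra.adjoin_le ?_
  rintro _ ⟨m, rfl⟩
  change ExteriorAlgebra.ι ℂ m ∈ _
  rw [← Finset.univ_sum_single m, map_sum]
  refine sum_mem fun i _ => ?_
  rw [← mul_one (m i), ← smul_eq_mul, Pi.single_smul', map_smul]
  exact Subalgebra.smul_mem _ (Algebra.subset_adjoin (Set.mem_range_self i)) _

theorem qExtHom_injective : Function.Injective (qExtHom b) := by
  refine (injective_iff_map_eq_zero _).2 fun x hx => ?_
  refine eq_zero_of_map_eq_zero_of_anticomm (qExtHom b)
    (a := fun i : Fin n => ExteriorAlgebra.ι ℂ (Pi.single i 1 : Fin n → ℂ))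
    (fun i j => eq_neg_of_add_eq_zero_left (ExteriorAlgebra.ι_add_mul_swap _ _)) ?_
    (by rw [adjoin_ι_single]; trivial) hx
  have : qExtHom b ∘ (fun i : Fin n => ExteriorAlgebra.ι ℂ (Pi.single i 1 : Fin n → ℂ)) =
      fun i : Fin n => q b (2 * (i : ℕ) + 1) := funext fun i => qExtHom_single b i
  rw [this, ← qProd_eq_sortedProd]
  exact linearIndependent_qProd b

theorem range_qExtHom : (qExtHom b).range = invariants V := by
  rw [← Algebra.map_top, ← adjoin_ι_single, AlgHom.map_adjoin, ← Set.range_comp,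
    ← adjoin_q_eq_invariants b]
  congr 2
  exact funext fun i => qExtHom_single b i

end Relations

end ExteriorInvariants

theorem theorem1p3 {V : Type*} [AddCommGroup V] [Module ℂ V] (n : ℕ)
    (b : Module.Basis (Fin n) ℂ V) :
    -- generation
    Algebra.adjoin ℂ (Set.range fun i : Fin n => ExteriorInvariants.q b (2 * (i : ℕ) + 1)) =
        ExteriorInvariants.invariants V ∧
    -- anticommutativity
    (∀ i j : Fin n,
      ExteriorInvariants.q b (2 * (i : ℕ) + 1) * ExteriorInvariants.q b (2 * (j : ℕ) + 1) =
        -(ExteriorInvariants.q b (2 * (j : ℕ) + 1) *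
          ExteriorInvariants.q b (2 * (i : ℕ) + 1))) ∧
    -- no other relations
    TwoSidedIdeal.ker (ExteriorInvariants.qHom b) = ExteriorInvariants.anticommIdeal n ∧
    -- the ordered products form a linear basis of the algebra of invariants
    (LinearIndependent ℂ (ExteriorInvariants.qProd b) ∧
      Submodule.span ℂ (Set.range (ExteriorInvariants.qProd b)) =
        Subalgebra.toSubmodule (ExteriorInvariants.invariants V)) ∧
    -- the algebra of invariants is an exterior algebra on these generators
    (∃ Φ : ExteriorAlgebra ℂ (Fin n → ℂ) ≃ₐ[ℂ] ExteriorInvariants.invariants V,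
      ∀ i : Fin n,
        ((Φ (ExteriorAlgebra.ι ℂ (Pi.single i 1)) : ExteriorInvariants.invariants V) :
          ExteriorInvariants.Ext V) = ExteriorInvariants.q b (2 * (i : ℕ) + 1)) := by
  exact ⟨ExteriorInvariants.adjoin_q_eq_invariants b,
    fun i j => ExteriorInvariants.q_anticomm b i j,
    ExteriorInvariants.ker_qHom b,
    ⟨ExteriorInvariants.linearIndependent_qProd b, by
      rw [← ExteriorInvariants.adjoin_q_eq_invariants b, ExteriorInvariants.qProd_eq_sortedProd]
      exact (ExteriorInvariants.adjoin_range_eq_span_sortedProd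
        (a := fun i : Fin n => ExteriorInvariants.q b (2 * (i : ℕ) + 1))
        fun i j => ExteriorInvariants.q_anticomm b i j).symm⟩,
    (AlgEquiv.ofInjective _ (ExteriorInvariants.qExtHom_injective b)).trans
      (Subalgebra.equivOfEq _ _ (ExteriorInvariants.range_qExtHom b)),
    fun i => ExteriorInvariants.qExtHom_single b i⟩
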